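/- All entropies are in bits. Let $n=2^t$ ($t\ge 0$), let $G_n=\bigl[\begin{smallmatrix}1&0\\1&1\end{smallmatrix}\bigr]^{\otimes t}$ over $\mathbb F_2$, and let $h(p)$ denote the Shannon entropy of the Bernoulli($p$) distribution on $\mathbb F_2$. For $p\in[0,1]$ and $\eta>0$ let $$R_\eta(p)=\{j\in\{1,\dots,n\}: H(Y_j\mid Y_1,\dots,Y_{j-1})\ge 1-\eta\},\qquad Y=XG_n,\quad X_1,\dots,X_n \text{ i.i.d. Bernoulli}(p).$$ Let $\varepsilon\in(0,1)$ and $0\le k\le n$, and let $p(k)\in[0,1]$ be either of the (at most two) parameters with $h(p(k))=k/n$. The polar extractor $\mathrm{Pext}:\mathbb F_2^n\to\mathbb F_2^m$ is $x\mapsto xG'$, where $G'$ is the matrix obtained from $G_n$ by deleting all columns whose index is not in $R_{\varepsilon^2/(2n)}(p(k))$, and $m=|R_{\varepsilon^2/(2n)}(p(k))|$. Then: 1. If $X=[X_1,\dots,X_n]$ is i.i.d. Bernoulli($p$), with any $p\in[0,1]$, and the Shannon entropy or the min-entropy $-\log_2\max_x \mathbb P(X=x)$ of $X$ is at least $k$,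 then $\mathrm{Pext}(X)$ is $\varepsilon$-uniform both in the entropy sense, $H(\mathrm{Pext}(X))\ge m(1-\varepsilon)$, and in the $l_1$ sense, $\sum_{u\in\mathbb F_2^m}\bigl|\mathbb P(\mathrm{Pext}(X)=u)-2^{-m}\bigr|\le\varepsilon$. 2. $m=k+o(n)$ as $n\to\infty$ along the powers of two, for fixed $\varepsilon$ and uniformly in $k$: for every $\varepsilon\in(0,1)$ and $\delta>0$ there is $N$ such that $|m-k|\le\delta n$ for all powers of two $n\ge N$, all real $k\in[0,n]$ and either choice of $p(k)$. -/

import Mathlib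

open scoped Kronecker

namespace PolarExtractor

open MeasureTheory ProbabilityTheory

noncomputable section

/-- Shannon entropy, in bits, of a random variable with finitely many values:
`H(Z) = ∑ s, P(Z = s) log₂ (1 / P(Z = s))`. -/
def entropy {Ω : Type*} [MeasurableSpace Ω] {S : Type*} [Fintype S]
    (μ : Measure Ω) (Z : Ω → S) : ℝ :=
  ∑ s, Real.negMulLog (μ.real (Z ⁻¹' {s})) / Real.log 2

/-- Conditional Shannon entropy, in bits: `H(Z | W) = ∑ w, P(W = w) H(Z | W = w)`. -/
def condEntropy {Ω : Type*} [MeasurableSpace Ω] {S T : Type*} [Fintype S] [Fintype T]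
    (μ : Measure Ω) (Z : Ω → S) (W : Ω → T) : ℝ :=
  ∑ w, μ.real (W ⁻¹' {w}) * entropy (cond μ (W ⁻¹' {w})) Z

/-- Min-entropy, in bits: `- log₂ (max_s P(Z = s))`. -/
def minEntropy {Ω : Type*} [MeasurableSpace Ω] {S : Type*}
    (μ : Measure Ω) (Z : Ω → S) : ℝ :=
  - Real.logb 2 (⨆ s, μ.real (Z ⁻¹' {s}))

/-- `Z`, with values in `𝔽₂^ι`, is `ε`-uniform in the entropy sense: `H(Z) ≥ |ι| (1 - ε)`. -/
def IsEntropyUniform {Ω : Type*} [MeasurableSpace Ω] {ι : Type*} [Fintype ι] [DecidableEq ι]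
    (ε : ℝ) (μ : Measure Ω) (Z : Ω → ι → ZMod 2) : Prop :=
  (Fintype.card ι : ℝ) * (1 - ε) ≤ entropy μ Z

/-- `Z`, with values in `𝔽₂^ι`, is `ε`-uniform in the `l1` sense: the (unnormalised) `l1` distance
between the law of `Z` and the uniform distribution is at most `ε`. -/
def IsL1Uniform {Ω : Type*} [MeasurableSpace Ω] {ι : Type*} [Fintype ι] [DecidableEq ι]
    (ε : ℝ) (μ : Measure Ω) (Z : Ω → ι → ZMod 2) : Prop :=
  ∑ u : ι → ZMod 2, |μ.real (Z ⁻¹' {u}) - 1 / 2 ^ Fintype.card ι| ≤ ε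

/-- The Bernoulli(`p`) distribution on `𝔽₂`. -/
def bernoulliLaw (p : unitInterval) : Measure (ZMod 2) :=
  bernoulliMeasure 1 0 p

/-- `X = [X_1, …, X_n]` is i.i.d. Bernoulli(`p`) under `μ`. -/
structure IsIIDBernoulli {Ω : Type*} [MeasurableSpace Ω] {n : ℕ}
    (p : unitInterval) (μ : Measure Ω) (X : Fin n → Ω → ZMod 2) : Prop where
  measurable : ∀ i, Measurable (X i)
  law : ∀ i, μ.map (X i) = bernoulliLaw p
  indep : iIndepFun X μ

/-- The entropy, in bits, of the Bernoulli(`p`) distribution. -/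
def bernoulliEntropy (p : unitInterval) : ℝ := Real.binEntropy (p : ℝ) / Real.log 2

/-- The polar matrix `G_n = [1 0; 1 1]^{⊗ t}` over `𝔽₂`, where `n = 2 ^ t`. The row (column) index
`(a, b)` of a Kronecker product `A ⊗ B` with `B` of size two is the number `2 a + b`. -/
def polarMatrix : (t : ℕ) → Matrix (Fin (2 ^ t)) (Fin (2 ^ t)) (ZMod 2)
  | 0 => 1
  | t + 1 =>
    Matrix.reindex (finProdFinEquiv.trans (finCongr (pow_succ 2 t).symm))
      (finProdFinEquiv.trans (finCongr (pow_succ 2 t).symm))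
      (polarMatrix t ⊗ₖ !![1, 0; 1, 1])

/-- `H(Y_j | Y^{j-1})` for `Y = X G_n`, where `n = 2 ^ t` and `X` is i.i.d. Bernoulli(`p`). -/
def polarCondEntropy (t : ℕ) (p : unitInterval) (j : Fin (2 ^ t)) : ℝ :=
  condEntropy (Measure.pi fun _ : Fin (2 ^ t) => bernoulliLaw p)
    (fun x => Matrix.vecMul x (polarMatrix t) j)
    (fun x (i : {i : Fin (2 ^ t) // i < j}) => Matrix.vecMul x (polarMatrix t) i)

open Classical in
/-- `R_ε(p) = {j ∈ [n] : H(Y_j | Y^{j-1}) ≥ 1 - ε}`, where `n = 2 ^ t`. -/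
def highEntropySet (t : ℕ) (ε : ℝ) (p : unitInterval) : Finset (Fin (2 ^ t)) :=
  Finset.univ.filter fun j => 1 - ε ≤ polarCondEntropy t p j

/-- `q` is the parameter of one of the (at most two) Bernoulli distributions of entropy `k / n`,
where `n = 2 ^ t`. -/
def IsParam (t : ℕ) (k : ℝ) (q : unitInterval) : Prop :=
  bernoulliEntropy q = k / 2 ^ t

/-- The set of columns that the extractor keeps: `R_{ε² / (2n)}(q)`, where `n = 2 ^ t`. -/
def pextSet (t : ℕ) (ε : ℝ) (q : unitInterval) : Finset (Fin (2 ^ t)) :=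
  highEntropySet t (ε ^ 2 / (2 * 2 ^ t)) q

/-- The matrix of the polar extractor: `G_n` without the columns outside of
`R_{ε² / (2n)}(q)`. -/
def pextMatrix (t : ℕ) (ε : ℝ) (q : unitInterval) :
    Matrix (Fin (2 ^ t)) (pextSet t ε q) (ZMod 2) :=
  (polarMatrix t).submatrix id Subtype.val

/-- The polar extractor as a map `𝔽₂^n → 𝔽₂^m`, where `n = 2 ^ t`. -/
def pext (t : ℕ) (ε : ℝ) (q : unitInterval) (x : Fin (2 ^ t) → ZMod 2) : pextSet t ε q → ZMod 2 :=
  Matrix.vecMul x (pextMatrix t ε q)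

/-- The number `m` of output bits of the polar extractor. -/
def pextLength (t : ℕ) (ε : ℝ) (q : unitInterval) : ℕ := (pextSet t ε q).card

end

end PolarExtractor

/-! Write n = 2^t and let q be the design parameter, of entropy k/n.

Uniformity. Either entropy hypothesis gives h(q) ≤ h(p), because min-entropy is at most Shannon
entropy and H(X) = n h(p). Then |1 - 2p| ≤ |1 - 2q|, so Bernoulli(p) is Bernoulli(q) plus
independent Bernoulli noise. Since the polar transform is linear, fixed noise only shifts Y_j and
relabels its past; concavity of conditional entropy then shows that no H(Y_j | Y^{j-1}) drops from q
to p (`polarEnt_mono`). The indices selected for q are thus good for p. By the chain rule,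
forgetting the columns that are not kept, the output entropy is at least m(1 - ε²/(2n)) ≥ m - ε²/2
bits. This gives the entropy claim, and Pinsker's inequality turns it into the l1 claim.

Length. The conditional entropies sum to k, so m cannot exceed k by more than 1/2. The converse is
polarization with a rate, run on the expected conditional bias b of Y_j instead of its entropy: one
polarization step sends b to b² and to at most 2b - b² (`bias_minus`, `bias_plus_le`). The average
of b^{1/4} over a level cannot increase, and drops by a definite amount whenever many biases are far
from 0 and 1; hence some level before a bound N independent of the source is polarized
(`exists_level_polarized`). There, the fraction of biases near 0 is almost h(q), because the entropy
given the bias is at most h((1 - b)/2). Once b is small, its fourth root contracts on average by 3/4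
per step, faster than 2^{-1/4}, so most descendants have bias below ε²/(2n)
(`exists_level_small_bias`). Since entropy in bits is at least 1 - b, those indices are selected. -/

namespace PolarExtractor

open MeasureTheory ProbabilityTheory

/-! ### Concavity of binary entropy for unnormalised weights -/

/-- The unnormalised entropy, in nats, of a weight on two points: the joint entropy minus the
entropy of the total weight. -/
noncomputable def phi (a b : ℝ) : ℝ :=
  Real.negMulLog a + Real.negMulLog b - Real.negMulLog (a + b)

lemma phi_comm (a b : ℝ) : phi a b = phi b a := by
  unfold phi; rw [add_comm b a]; ring

lemma phi_mul (c a b : ℝ) : phi (c * a) (c * b) = c * phi a b := by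
  unfold phi
  rw [← mul_add]
  simp only [Real.negMulLog_mul]
  ring

lemma phi_one_sub (x : ℝ) : phi x (1 - x) = Real.binEntropy x := by
  simp [phi, Real.binEntropy_eq_negMulLog_add_negMulLog_one_sub]

@[simp] lemma phi_zero : phi 0 0 = 0 := by simp [phi]

lemma phi_eq {a b : ℝ} (h : a + b ≠ 0) : phi a b = (a + b) * Real.binEntropy (a / (a + b)) := by
  rw [← phi_one_sub, ← phi_mul]
  congr 1
  · field_simp
  · field_simp; ring

/-- By `phi_eq`, `phi` is the perspective of the concave binary entropy: concave and homogeneous of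
degree one, hence superadditive. Both "conditioning on less" and concavity in the law rest on this.
-/
lemma phi_add_le {a b c d : ℝ} (ha : 0 ≤ a) (hb : 0 ≤ b) (hc : 0 ≤ c) (hd : 0 ≤ d) :
    phi a b + phi c d ≤ phi (a + c) (b + d) := by
  rcases (add_nonneg ha hb).eq_or_lt with h | h
  · have h1 : a = 0 := by linarith
    have h2 : b = 0 := by linarith
    simp [h1, h2]
  rcases (add_nonneg hc hd).eq_or_lt with h' | h'
  · have h1 : c = 0 := by linarith
    have h2 : d = 0 := by linarith
    simp [h1, h2]
  have hs : 0 < a + c + (b + d) := by linarith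
  rw [phi_eq h.ne', phi_eq h'.ne', phi_eq hs.ne']
  have key := Real.strictConcave_binEntropy.concaveOn.2
    (show a / (a + b) ∈ Set.Icc (0 : ℝ) 1 from ⟨by positivity, by rw [div_le_one h]; linarith⟩)
    (show c / (c + d) ∈ Set.Icc (0 : ℝ) 1 from ⟨by positivity, by rw [div_le_one h']; linarith⟩)
    (show 0 ≤ (a + b) / (a + c + (b + d)) by positivity)
    (show 0 ≤ (c + d) / (a + c + (b + d)) by positivity) (by field_simp; ring)
  simp only [smul_eq_mul] at key
  have e : (a + b) / (a + c + (b + d)) * (a / (a + b)) + (c + d) / (a + c + (b + d)) * (c / (c + d))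
      = (a + c) / (a + c + (b + d)) := by field_simp
  rw [e] at key
  have := mul_le_mul_of_nonneg_left key hs.le
  refine le_trans (le_of_eq ?_) this
  field_simp

lemma phi_sum_le {ι : Type*} (s : Finset ι) (f g : ι → ℝ) (hf : ∀ i ∈ s, 0 ≤ f i)
    (hg : ∀ i ∈ s, 0 ≤ g i) : ∑ i ∈ s, phi (f i) (g i) ≤ phi (∑ i ∈ s, f i) (∑ i ∈ s, g i) := by
  classical
  induction s using Finset.induction_on with
  | empty => simp
  | insert i s hi ih =>
    rw [Finset.sum_insert hi, Finset.sum_insert hi, Finset.sum_insert hi]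
    simp only [Finset.mem_insert, forall_eq_or_imp] at hf hg
    exact (add_le_add_right (ih hf.2 hg.2) _).trans
      (phi_add_le hf.1 hg.1 (Finset.sum_nonneg hf.2) (Finset.sum_nonneg hg.2))

lemma phi_min_max (a b : ℝ) : phi (min a b) (max a b) = phi a b := by
  rcases le_total a b with h | h
  · simp [h]
  · simp [h, phi_comm]

lemma two_mul_mul_log_two_le_binEntropy {x : ℝ} (h0 : 0 ≤ x) (h1 : x ≤ 2⁻¹) :
    2 * x * Real.log 2 ≤ Real.binEntropy x := by
  have key := Real.strictConcave_binEntropy.concaveOn.2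
    (show (2⁻¹ : ℝ) ∈ Set.Icc (0 : ℝ) 1 by constructor <;> norm_num)
    (show (0 : ℝ) ∈ Set.Icc (0 : ℝ) 1 by simp)
    (show 0 ≤ 2 * x by linarith) (show 0 ≤ 1 - 2 * x by linarith) (by ring)
  simp only [smul_eq_mul, Real.binEntropy_zero, Real.binEntropy_two_inv, mul_zero, add_zero] at key
  rwa [show 2 * x * 2⁻¹ = x by ring] at key

lemma sub_abs_mul_log_two_le_phi {a b : ℝ} (ha : 0 ≤ a) (hb : 0 ≤ b) :
    (a + b - |a - b|) * Real.log 2 ≤ phi a b := by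
  wlog hab : a ≤ b generalizing a b
  · rw [phi_comm, abs_sub_comm, add_comm a b]
    exact this hb ha (le_of_not_ge hab)
  rcases (add_nonneg ha hb).eq_or_lt with h | h
  · have h1 : a = 0 := by linarith
    have h2 : b = 0 := by linarith
    simp [h1, h2]
  rw [phi_eq h.ne', abs_of_nonpos (by linarith)]
  have := mul_le_mul_of_nonneg_left (two_mul_mul_log_two_le_binEntropy
    (x := a / (a + b)) (by positivity) (by rw [div_le_iff₀ h]; linarith)) h.le
  refine le_trans (le_of_eq ?_) this
  field_simp
  ring

/-- Sort each pair, then merge all cells: superadditivity bounds the sum by the entropy of the total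
of the minima, which is the error probability (1 - bias)/2 of guessing the bit. -/
lemma sum_phi_le_binEntropy {ι : Type*} (s : Finset ι) (f g : ι → ℝ) (hf : ∀ i ∈ s, 0 ≤ f i)
    (hg : ∀ i ∈ s, 0 ≤ g i) (h : ∑ i ∈ s, (f i + g i) = 1) :
    ∑ i ∈ s, phi (f i) (g i) ≤ Real.binEntropy ((1 - ∑ i ∈ s, |f i - g i|) / 2) := by
  have h1 : ∑ i ∈ s, min (f i) (g i) = (1 - ∑ i ∈ s, |f i - g i|) / 2 := by
    rw [← h, ← Finset.sum_sub_distrib, Finset.sum_div]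
    exact Finset.sum_congr rfl fun i _ => by
      rcases le_total (f i) (g i) with hi | hi
      · rw [min_eq_left hi, abs_of_nonpos (by linarith)]; ring
      · rw [min_eq_right hi, abs_of_nonneg (by linarith)]; ring
  have h2 : ∑ i ∈ s, max (f i) (g i) = 1 - (1 - ∑ i ∈ s, |f i - g i|) / 2 := by
    rw [← h1, ← h, ← Finset.sum_sub_distrib]
    exact Finset.sum_congr rfl fun i _ => by linarith [min_add_max (f i) (g i)]
  have := phi_sum_le s (fun i => min (f i) (g i)) (fun i => max (f i) (g i))
    (fun i hi => le_min (hf i hi) (hg i hi)) (fun i hi => le_max_of_le_left (hf i hi))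
  simp only [phi_min_max] at this
  rwa [h2, h1, phi_one_sub] at this

/-! ### Pinsker's inequality -/

/-- The pointwise inequality behind Pinsker's inequality. -/
lemma three_mul_sub_one_sq_le {x : ℝ} (hx : 0 ≤ x) :
    3 * (x - 1) ^ 2 ≤ (2 * x + 4) * (x * Real.log x + 1 - x) := by
  rcases hx.eq_or_lt with rfl | hx
  · norm_num
  -- This function is the derivative of (y log y + 1 - y) - 3(y - 1)²/(2y + 4). It vanishes at 1 and
  -- is increasing, since (y + 2)³ ≥ 27y by AM-GM; so the difference is smallest at 1, where it is
  -- 0.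
  have hl : ∀ y : ℝ, 0 < y → HasDerivAt (fun y : ℝ => Real.log y - 3 / 2 + 27 / 2 * ((y + 2) ^ 2)⁻¹)
      (y⁻¹ - 27 * ((y + 2) ^ 3)⁻¹) y := by
    intro y hy
    have h1 : HasDerivAt (fun y : ℝ => (y + 2) ^ 2) (2 * (y + 2)) y := by
      simpa using ((hasDerivAt_id y).add_const (2 : ℝ)).fun_pow 2
    have h2 := ((Real.hasDerivAt_log hy.ne').sub_const (3 / 2)).fun_add
      ((h1.fun_inv (by positivity)).const_mul (27 / 2))
    refine h2.congr_deriv ?_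
    field_simp
    ring
  have hm : MonotoneOn (fun y : ℝ => Real.log y - 3 / 2 + 27 / 2 * ((y + 2) ^ 2)⁻¹)
      (Set.Ioi 0) := by
    refine monotoneOn_of_hasDerivWithinAt_nonneg (convex_Ioi 0)
      (fun y hy => (hl y hy).continuousAt.continuousWithinAt)
      (fun y hy => (hl y (by simpa using hy)).hasDerivWithinAt) fun y hy => ?_
    have hy : 0 < y := by simpa using hy
    have : 27 * ((y + 2) ^ 3)⁻¹ ≤ y⁻¹ := by
      rw [← div_eq_mul_inv, inv_eq_one_div, div_le_div_iff₀ (by positivity) hy]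
      nlinarith [mul_nonneg hy.le (sq_nonneg (y - 1)), sq_nonneg (y - 1)]
    linarith
  have hk : ∀ y : ℝ, 0 < y → HasDerivAt
      (fun y : ℝ => y * Real.log y + 1 - y - 3 * (y - 1) ^ 2 * (2 * y + 4)⁻¹)
      (Real.log y - 3 / 2 + 27 / 2 * ((y + 2) ^ 2)⁻¹) y := by
    intro y hy
    have h1 : HasDerivAt (fun y : ℝ => 3 * (y - 1) ^ 2) (3 * (2 * (y - 1))) y := by
      simpa using (((hasDerivAt_id y).sub_const (1 : ℝ)).fun_pow 2).const_mul 3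
    have h2 : HasDerivAt (fun y : ℝ => 2 * y + 4) 2 y := by
      simpa using ((hasDerivAt_id y).const_mul (2 : ℝ)).add_const 4
    have h3 := (((Real.hasDerivAt_mul_log hy.ne').add_const 1).fun_sub (hasDerivAt_id y)).fun_sub
      (h1.fun_mul (h2.fun_inv (by positivity)))
    refine h3.congr_deriv ?_
    have : y + 2 ≠ 0 := by positivity
    have : 2 * y + 4 ≠ 0 := by positivity
    field_simp
    ring
  have h0 : 0 ≤ x * Real.log x + 1 - x - 3 * (x - 1) ^ 2 * (2 * x + 4)⁻¹ := by
    have e1 : (fun y : ℝ => y * Real.log y + 1 - y - 3 * (y - 1) ^ 2 * (2 * y + 4)⁻¹) 1 = 0 := by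
      norm_num
    rcases le_total 1 x with h | h
    · have : MonotoneOn (fun y : ℝ => y * Real.log y + 1 - y - 3 * (y - 1) ^ 2 * (2 * y + 4)⁻¹)
          (Set.Ici 1) := by
        refine monotoneOn_of_hasDerivWithinAt_nonneg (convex_Ici 1)
          (fun y hy => (hk y (zero_lt_one.trans_le hy)).continuousAt.continuousWithinAt)
          (fun y hy => (hk y (zero_lt_one.trans_le (interior_subset hy))).hasDerivWithinAt)
          fun y hy => ?_
        have hy : (1 : ℝ) ≤ y := interior_subset hy
        have := hm (Set.mem_Ioi.2 zero_lt_one) (Set.mem_Ioi.2 (by linarith)) hy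
        norm_num at this ⊢
        linarith
      exact e1 ▸ this (Set.mem_Ici.2 le_rfl) (Set.mem_Ici.2 h) h
    · have : AntitoneOn (fun y : ℝ => y * Real.log y + 1 - y - 3 * (y - 1) ^ 2 * (2 * y + 4)⁻¹)
          (Set.Ioc 0 1) := by
        refine antitoneOn_of_hasDerivWithinAt_nonpos (convex_Ioc 0 1)
          (fun y hy => (hk y hy.1).continuousAt.continuousWithinAt)
          (fun y hy => (hk y (interior_subset hy).1).hasDerivWithinAt)
          fun y hy => ?_
        have hy : y ∈ Set.Ioc (0 : ℝ) 1 := interior_subset hy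
        have := hm (Set.mem_Ioi.2 hy.1) (Set.mem_Ioi.2 zero_lt_one) hy.2
        norm_num at this ⊢
        linarith
      exact e1 ▸ this ⟨hx, h⟩ ⟨zero_lt_one, le_rfl⟩ h
  have h4 : (0 : ℝ) < 2 * x + 4 := by linarith
  have := mul_nonneg h4.le h0
  rw [mul_sub, mul_comm (3 * (x - 1) ^ 2), mul_inv_cancel_left₀ h4.ne'] at this
  linarith

/-- Pinsker's inequality for the uniform distribution on a finite set. -/
lemma sq_sum_abs_sub_le {S : Type*} [Fintype S] [Nonempty S] (P : S → ℝ) (h0 : ∀ s, 0 ≤ P s)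
    (h1 : ∑ s, P s = 1) :
    (∑ s, |P s - 1 / (Fintype.card S : ℝ)|) ^ 2 ≤
      2 * (Real.log (Fintype.card S) - ∑ s, Real.negMulLog (P s)) := by
  set N : ℝ := (Fintype.card S : ℝ) with hN
  have hNpos : 0 < N := by rw [hN]; exact_mod_cast Fintype.card_pos
  set A : S → ℝ := fun s => (2 * (N * P s) + 4) / N
  set B : S → ℝ := fun s => (N * P s * Real.log (N * P s) + 1 - N * P s) / N
  have hpos : ∀ s, 0 ≤ N * P s := fun s => mul_nonneg hNpos.le (h0 s)
  have hA : ∀ s, 0 ≤ A s := fun s => by have := hpos s; positivity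
  have hB : ∀ s, 0 ≤ B s := fun s =>
    div_nonneg (InformationTheory.klFun_nonneg (hpos s)) hNpos.le
  have hle : ∀ s, |P s - 1 / N| ≤ √(A s) * √(B s) / √3 := by
    intro s
    rw [← Real.sqrt_mul (hA s), ← Real.sqrt_div (mul_nonneg (hA s) (hB s))]
    refine Real.abs_le_sqrt ?_
    have e : A s * B s = (2 * (N * P s) + 4) * (N * P s * Real.log (N * P s) + 1 - N * P s) / N ^ 2 := by
      simp only [A, B]; field_simp
    have e2 : (P s - 1 / N) ^ 2 = (N * P s - 1) ^ 2 / N ^ 2 := by field_simp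
    rw [e, e2, div_div, div_le_div_iff₀ (by positivity) (by positivity)]
    have := mul_le_mul_of_nonneg_right (three_mul_sub_one_sq_le (hpos s)) (sq_nonneg N)
    linarith
  have hsum : ∑ s, |P s - 1 / N| ≤ (∑ s, √(A s) * √(B s)) / √3 := by
    rw [Finset.sum_div]; exact Finset.sum_le_sum fun s _ => hle s
  -- Cauchy–Schwarz splits the pointwise bound: this total over the 3 on its left side gives
  -- Pinsker's constant 2, and the other factor is the divergence from uniform.
  have hSA : ∑ s, A s = 6 := by
    simp only [A, ← Finset.sum_div, Finset.sum_add_distrib, ← Finset.mul_sum, h1]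
    simp only [Finset.sum_const, Finset.card_univ, nsmul_eq_mul, ← hN]
    field_simp; norm_num
  have hSB : ∑ s, B s = Real.log N - ∑ s, Real.negMulLog (P s) := by
    have : ∀ s, B s = P s * Real.log N - Real.negMulLog (P s) + 1 / N - P s := by
      intro s
      simp only [B]
      rcases (h0 s).eq_or_lt with h | h
      · simp [← h]
      · rw [Real.log_mul hNpos.ne' h.ne', Real.negMulLog]
        field_simp
        ring
    simp only [this, Finset.sum_add_distrib, Finset.sum_sub_distrib, ← Finset.sum_mul, h1]
    simp only [Finset.sum_const, Finset.card_univ, nsmul_eq_mul, ← hN]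
    field_simp; ring
  have hcs : (∑ s, √(A s) * √(B s)) ^ 2 ≤ (∑ s, A s) * ∑ s, B s := by
    refine (Finset.sum_mul_sq_le_sq_mul_sq _ _ _).trans (le_of_eq ?_)
    simp only [Real.sq_sqrt (hA _), Real.sq_sqrt (hB _)]
  calc (∑ s, |P s - 1 / N|) ^ 2 ≤ ((∑ s, √(A s) * √(B s)) / √3) ^ 2 :=
        pow_le_pow_left₀ (Finset.sum_nonneg fun s _ => abs_nonneg _) hsum 2
    _ ≤ _ := by
        rw [div_pow, Real.sq_sqrt (by norm_num), ← hSB]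
        rw [hSA] at hcs
        linarith

lemma sum_zmod_two {M : Type*} [AddCommMonoid M] (f : ZMod 2 → M) : ∑ a, f a = f 0 + f 1 :=
  Fin.sum_univ_two f

/-! ### Entropy and bias on a finite weighted space -/

section Finite

variable {Ω Ω' S T A B : Type*} [Fintype Ω] [Fintype Ω'] [Fintype S] [Fintype T] [Fintype A]
  [Fintype B]

open Classical in
/-- The law of `Z` under the weight `w` on a finite sample space. -/
noncomputable def fiberWeight {S : Type*} (w : Ω → ℝ) (Z : Ω → S) (s : S) : ℝ :=
  ∑ x with Z x = s, w x

/-- Shannon entropy, in nats. -/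
noncomputable def ent (w : Ω → ℝ) (Z : Ω → S) : ℝ := ∑ s, Real.negMulLog (fiberWeight w Z s)

/-- Conditional Shannon entropy, in nats, of a binary random variable. -/
noncomputable def condEnt (w : Ω → ℝ) (Z : Ω → ZMod 2) (W : Ω → S) : ℝ :=
  ∑ v, phi (fiberWeight w (fun x => (Z x, W x)) (0, v)) (fiberWeight w (fun x => (Z x, W x)) (1, v))

/-- The expected conditional bias `𝔼 |P(Z = 0 | W) - P(Z = 1 | W)|` of a binary random variable. -/
noncomputable def bias (w : Ω → ℝ) (Z : Ω → ZMod 2) (W : Ω → S) : ℝ :=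
  ∑ v, |fiberWeight w (fun x => (Z x, W x)) (0, v) - fiberWeight w (fun x => (Z x, W x)) (1, v)|

open Classical in
lemma fiberWeight_eq_sum_ite {S : Type*} (w : Ω → ℝ) (Z : Ω → S) (s : S) :
    fiberWeight w Z s = ∑ x, if Z x = s then w x else 0 := by
  rw [fiberWeight, Finset.sum_filter]

lemma fiberWeight_nonneg {S : Type*} {w : Ω → ℝ} (hw : ∀ x, 0 ≤ w x) (Z : Ω → S) (s : S) :
    0 ≤ fiberWeight w Z s := Finset.sum_nonneg fun x _ => hw x

lemma sum_fiberWeight (w : Ω → ℝ) (Z : Ω → S) : ∑ s, fiberWeight w Z s = ∑ x, w x := by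
  classical
  simp only [fiberWeight_eq_sum_ite]
  rw [Finset.sum_comm]
  simp

lemma sum_fiberWeight_mid {S T : Type*} (w : Ω → ℝ) (Z : Ω → S) (V : Ω → A) (W : Ω → T) (s : S)
    (t : T) : ∑ v, fiberWeight w (fun x => (Z x, V x, W x)) (s, v, t) =
      fiberWeight w (fun x => (Z x, W x)) (s, t) := by
  classical
  simp only [fiberWeight_eq_sum_ite]
  rw [Finset.sum_comm]
  refine Finset.sum_congr rfl fun x _ => ?_
  by_cases h1 : Z x = s <;> by_cases h2 : W x = t <;> simp [h1, h2]

lemma fiberWeight_eq_add {S : Type*} (w : Ω → ℝ) (Z : Ω → ZMod 2) (W : Ω → S) (v : S) :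
    fiberWeight w W v = fiberWeight w (fun x => (Z x, W x)) (0, v) +
      fiberWeight w (fun x => (Z x, W x)) (1, v) := by
  classical
  rw [← sum_zmod_two (fun a => fiberWeight w (fun x => (Z x, W x)) (a, v))]
  simp only [fiberWeight_eq_sum_ite]
  rw [Finset.sum_comm]
  refine Finset.sum_congr rfl fun x _ => ?_
  by_cases h2 : W x = v <;> simp [h2]

lemma ent_pair (w : Ω → ℝ) (Z : Ω → ZMod 2) (W : Ω → S) :
    ent w (fun x => (Z x, W x)) = ent w W + condEnt w Z W := by
  simp only [ent, condEnt, phi, Fintype.sum_prod_type, sum_zmod_two, ← fiberWeight_eq_add,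
    ← Finset.sum_add_distrib]
  exact Finset.sum_congr rfl fun v _ => by ring

-- Values that are not attained have empty fibers and contribute `F ∅ = 0`; attained values
-- correspond to distinct fibers.
open Classical in
lemma sum_fiber_eq_sum_image (F : Finset Ω → ℝ) (h0 : F ∅ = 0) (W : Ω → A) :
    ∑ v, F {x | W x = v} =
      ∑ s ∈ Finset.univ.image (fun x => ({y | W y = W x} : Finset Ω)), F s := by
  have : Finset.univ.image (fun x => ({y | W y = W x} : Finset Ω)) =
      (Finset.univ.image W).image (fun v => ({y | W y = v} : Finset Ω)) := by
    rw [Finset.image_image]; rfl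
  rw [this, Finset.sum_image]
  · refine (Finset.sum_subset (Finset.subset_univ _) fun v _ hv => ?_).symm
    rw [Finset.filter_false_of_mem, h0]
    intro x _ hx
    exact hv (Finset.mem_image.2 ⟨x, Finset.mem_univ _, hx⟩)
  · intro v hv v' hv' e
    obtain ⟨x, -, rfl⟩ := Finset.mem_image.1 (Finset.mem_coe.1 hv)
    simpa using Finset.ext_iff.1 e x

open Classical in
/-- A sum over the fibers of a map depends only on the kernel of the map. -/
lemma sum_fiber_congr (F : Finset Ω → ℝ) (h0 : F ∅ = 0) (W : Ω → A) (W' : Ω → B)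
    (h : ∀ x y, W x = W y ↔ W' x = W' y) :
    ∑ v, F {x | W x = v} = ∑ v, F {x | W' x = v} := by
  rw [sum_fiber_eq_sum_image F h0 W, sum_fiber_eq_sum_image F h0 W']
  congr 2
  ext x y
  simp [h]

lemma fiberWeight_pair_eq {S : Type*} (w : Ω → ℝ) (Z : Ω → ZMod 2) (W : Ω → S)
    (a : ZMod 2) (v : S) [DecidablePred fun x => W x = v] :
    fiberWeight w (fun x => (Z x, W x)) (a, v) =
      ∑ x ∈ ({x | W x = v} : Finset Ω) with Z x = a, w x := by
  classical
  rw [fiberWeight_eq_sum_ite, Finset.sum_filter, Finset.sum_filter]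
  refine Finset.sum_congr rfl fun x _ => ?_
  by_cases h1 : W x = v <;> by_cases h2 : Z x = a <;> simp [h1, h2]

lemma ent_congr (w : Ω → ℝ) {W : Ω → A} {W' : Ω → B} (h : ∀ x y, W x = W y ↔ W' x = W' y) :
    ent w W = ent w W' :=
  sum_fiber_congr (fun s => Real.negMulLog (∑ x ∈ s, w x)) (by simp) W W' h

lemma condEnt_congr (w : Ω → ℝ) (Z : Ω → ZMod 2) {W : Ω → A} {W' : Ω → B}
    (h : ∀ x y, W x = W y ↔ W' x = W' y) : condEnt w Z W = condEnt w Z W' := by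
  classical
  simp only [condEnt, fiberWeight_pair_eq]
  exact sum_fiber_congr (fun s => phi (∑ x ∈ s with Z x = 0, w x) (∑ x ∈ s with Z x = 1, w x))
    (by simp) W W' h

lemma bias_congr (w : Ω → ℝ) (Z : Ω → ZMod 2) {W : Ω → A} {W' : Ω → B}
    (h : ∀ x y, W x = W y ↔ W' x = W' y) : bias w Z W = bias w Z W' := by
  classical
  simp only [bias, fiberWeight_pair_eq]
  exact sum_fiber_congr (fun s => |(∑ x ∈ s with Z x = 0, w x) - (∑ x ∈ s with Z x = 1, w x)|)
    (by simp) W W' h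

/-- Conditioning on less does not decrease entropy. -/
lemma condEnt_le_of_refines {w : Ω → ℝ} (hw : ∀ x, 0 ≤ w x) (Z : Ω → ZMod 2) {W : Ω → A}
    {W' : Ω → B} (h : ∀ x y, W x = W y → W' x = W' y) : condEnt w Z W ≤ condEnt w Z W' := by
  -- `W'` is a function of `W`, so adjoining it changes nothing. Dropping `W` then merges cells,
  -- where superadditivity applies.
  rw [condEnt_congr w Z (W := W) (W' := fun x => (W x, W' x))
    (fun x y => by simpa using h x y)]
  simp only [condEnt, Fintype.sum_prod_type]
  rw [Finset.sum_comm]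
  refine Finset.sum_le_sum fun v' _ => ?_
  simp only [← sum_fiberWeight_mid w Z W W']
  exact phi_sum_le _ _ _ (fun _ _ => fiberWeight_nonneg hw _ _)
    (fun _ _ => fiberWeight_nonneg hw _ _)

lemma fiberWeight_sum_mul {S ι : Type*} [Fintype ι] (c : ι → ℝ) (w : ι → Ω → ℝ) (Z : Ω → S)
    (s : S) : fiberWeight (fun x => ∑ i, c i * w i x) Z s = ∑ i, c i * fiberWeight (w i) Z s := by
  simp only [fiberWeight, Finset.mul_sum]
  rw [Finset.sum_comm]

/-- Conditional entropy is a concave function of the law. -/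
lemma sum_mul_condEnt_le {ι : Type*} [Fintype ι] (c : ι → ℝ) (hc : ∀ i, 0 ≤ c i) (w : ι → Ω → ℝ)
    (hw : ∀ i x, 0 ≤ w i x) (Z : Ω → ZMod 2) (W : Ω → S) :
    ∑ i, c i * condEnt (w i) Z W ≤ condEnt (fun x => ∑ i, c i * w i x) Z W := by
  simp only [condEnt, fiberWeight_sum_mul, Finset.mul_sum, ← phi_mul]
  rw [Finset.sum_comm]
  exact Finset.sum_le_sum fun v _ => phi_sum_le _ _ _
    (fun i _ => mul_nonneg (hc i) (fiberWeight_nonneg (hw i) _ _))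
    (fun i _ => mul_nonneg (hc i) (fiberWeight_nonneg (hw i) _ _))

lemma fiberWeight_comp_equiv {S : Type*} (e : Ω' ≃ Ω) (w : Ω → ℝ) (Z : Ω → S) (s : S) :
    fiberWeight (fun x => w (e x)) (fun x => Z (e x)) s = fiberWeight w Z s := by
  classical
  simp only [fiberWeight_eq_sum_ite]
  exact e.sum_comp (fun x => if Z x = s then w x else 0)

lemma ent_eq_of_equiv (e : Ω' ≃ Ω) {w' : Ω' → ℝ} {Z' : Ω' → A} {w : Ω → ℝ} {Z : Ω → B}
    (hw : ∀ x, w' x = w (e x)) (hZ : ∀ x y, Z' x = Z' y ↔ Z (e x) = Z (e y)) :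
    ent w' Z' = ent w Z := by
  obtain rfl : w' = fun x => w (e x) := funext hw
  rw [ent_congr _ (W := Z') (W' := fun x => Z (e x)) hZ]
  simp only [ent, fiberWeight_comp_equiv]

lemma condEnt_eq_of_equiv (e : Ω' ≃ Ω) {w' : Ω' → ℝ} {Z' : Ω' → ZMod 2} {W' : Ω' → A}
    {w : Ω → ℝ} {Z : Ω → ZMod 2} {W : Ω → B} (hw : ∀ x, w' x = w (e x))
    (hZ : ∀ x, Z' x = Z (e x)) (hW : ∀ x y, W' x = W' y ↔ W (e x) = W (e y)) :
    condEnt w' Z' W' = condEnt w Z W := by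
  obtain rfl : w' = fun x => w (e x) := funext hw
  obtain rfl : Z' = fun x => Z (e x) := funext hZ
  rw [condEnt_congr _ _ (W := W') (W' := fun x => W (e x)) hW]
  simp only [condEnt, fiberWeight_comp_equiv e w (fun x => (Z x, W x))]

lemma bias_eq_of_equiv (e : Ω' ≃ Ω) {w' : Ω' → ℝ} {Z' : Ω' → ZMod 2} {W' : Ω' → A}
    {w : Ω → ℝ} {Z : Ω → ZMod 2} {W : Ω → B} (hw : ∀ x, w' x = w (e x))
    (hZ : ∀ x, Z' x = Z (e x)) (hW : ∀ x y, W' x = W' y ↔ W (e x) = W (e y)) :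
    bias w' Z' W' = bias w Z W := by
  obtain rfl : w' = fun x => w (e x) := funext hw
  obtain rfl : Z' = fun x => Z (e x) := funext hZ
  rw [bias_congr _ _ (W := W') (W' := fun x => W (e x)) hW]
  simp only [bias, fiberWeight_comp_equiv e w (fun x => (Z x, W x))]

lemma condEnt_add_const (w : Ω → ℝ) (Z : Ω → ZMod 2) (W : Ω → S) (c : ZMod 2) :
    condEnt w (fun x => Z x + c) W = condEnt w Z W := by
  have h : ∀ a v, fiberWeight w (fun x => (Z x + c, W x)) (a, v) =
      fiberWeight w (fun x => (Z x, W x)) (a - c, v) := by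
    intro a v
    classical
    simp only [fiberWeight_eq_sum_ite, Prod.mk.injEq, eq_sub_iff_add_eq]
  simp only [condEnt, h]
  refine Finset.sum_congr rfl fun v _ => ?_
  obtain rfl | rfl : c = 0 ∨ c = 1 := by
    clear h; revert c; decide
  · simp
  · rw [phi_comm]; rfl

lemma sum_fiberWeight_add (w : Ω → ℝ) (Z : Ω → ZMod 2) (W : Ω → S) :
    ∑ v, (fiberWeight w (fun x => (Z x, W x)) (0, v) + fiberWeight w (fun x => (Z x, W x)) (1, v))
      = ∑ x, w x := by
  simp only [← fiberWeight_eq_add, sum_fiberWeight]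

lemma bias_nonneg (w : Ω → ℝ) (Z : Ω → ZMod 2) (W : Ω → S) : 0 ≤ bias w Z W :=
  Finset.sum_nonneg fun _ _ => abs_nonneg _

lemma bias_le_one {w : Ω → ℝ} (hw : ∀ x, 0 ≤ w x) (h1 : ∑ x, w x = 1) (Z : Ω → ZMod 2)
    (W : Ω → S) : bias w Z W ≤ 1 := by
  rw [← h1, ← sum_fiberWeight_add w Z W]
  refine Finset.sum_le_sum fun v _ => abs_le.2 ?_
  have h0 := fiberWeight_nonneg hw (fun x => (Z x, W x)) (0, v)
  have h1 := fiberWeight_nonneg hw (fun x => (Z x, W x)) (1, v)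
  constructor <;> linarith

lemma one_sub_bias_mul_log_two_le {w : Ω → ℝ} (hw : ∀ x, 0 ≤ w x) (h1 : ∑ x, w x = 1)
    (Z : Ω → ZMod 2) (W : Ω → S) : (1 - bias w Z W) * Real.log 2 ≤ condEnt w Z W := by
  rw [← h1, ← sum_fiberWeight_add w Z W, bias, ← Finset.sum_sub_distrib, Finset.sum_mul]
  exact Finset.sum_le_sum fun v _ => sub_abs_mul_log_two_le_phi (fiberWeight_nonneg hw _ _)
    (fiberWeight_nonneg hw _ _)

lemma condEnt_le_binEntropy {w : Ω → ℝ} (hw : ∀ x, 0 ≤ w x) (h1 : ∑ x, w x = 1)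
    (Z : Ω → ZMod 2) (W : Ω → S) : condEnt w Z W ≤ Real.binEntropy ((1 - bias w Z W) / 2) :=
  sum_phi_le_binEntropy _ _ _ (fun _ _ => fiberWeight_nonneg hw _ _)
    (fun _ _ => fiberWeight_nonneg hw _ _) ((sum_fiberWeight_add w Z W).trans h1)

lemma fiberWeight_minus {S : Type*} (w : Ω → ℝ) (Z : Ω → ZMod 2) (W : Ω → S) (a : ZMod 2)
    (u v : S) :
    fiberWeight (fun x : Ω × Ω => w x.1 * w x.2) (fun x => (Z x.1 + Z x.2, W x.1, W x.2)) (a, u, v)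
      = ∑ b, fiberWeight w (fun x => (Z x, W x)) (b, u) *
          fiberWeight w (fun x => (Z x, W x)) (a - b, v) := by
  classical
  simp only [fiberWeight_eq_sum_ite, Finset.sum_mul_sum, Fintype.sum_prod_type]
  rw [Finset.sum_comm' (t' := Finset.univ) (s' := fun _ => Finset.univ) (by simp)]
  rw [Finset.sum_comm]
  conv_rhs => rw [Finset.sum_comm]
  refine Finset.sum_congr rfl fun x _ => ?_
  rw [Finset.sum_comm]
  refine Finset.sum_congr rfl fun y _ => ?_
  rw [Finset.sum_eq_single (Z x) (fun b _ hb => by simp [hb.symm]) (by simp)]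
  by_cases h1 : W x = u <;> by_cases h2 : W y = v <;> simp [h1, h2, eq_sub_iff_add_eq, add_comm]

lemma fiberWeight_plus {S : Type*} (w : Ω → ℝ) (Z : Ω → ZMod 2) (W : Ω → S) (a s : ZMod 2)
    (u v : S) :
    fiberWeight (fun x : Ω × Ω => w x.1 * w x.2)
      (fun x => (Z x.2, W x.1, W x.2, Z x.1 + Z x.2)) (a, u, v, s)
      = fiberWeight w (fun x => (Z x, W x)) (s - a, u) *
          fiberWeight w (fun x => (Z x, W x)) (a, v) := by
  classical
  simp only [fiberWeight_eq_sum_ite, Finset.sum_mul_sum, Fintype.sum_prod_type]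
  refine Finset.sum_congr rfl fun x _ => Finset.sum_congr rfl fun y _ => ?_
  by_cases h1 : W x = u <;> by_cases h2 : W y = v <;> by_cases h3 : Z y = a <;>
    simp [h1, h2, h3, eq_sub_iff_add_eq]

/-- The signed difference of the two masses is the nontrivial Fourier coefficient on `ZMod 2`, so it
multiplies under the convolution that gives the law of the sum. -/
lemma bias_minus (w : Ω → ℝ) (Z : Ω → ZMod 2) (W : Ω → S) :
    bias (fun x : Ω × Ω => w x.1 * w x.2) (fun x => Z x.1 + Z x.2) (fun x => (W x.1, W x.2)) =
      bias w Z W ^ 2 := by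
  simp only [bias, fiberWeight_minus, sum_zmod_two, Fintype.sum_prod_type, sq, Finset.sum_mul_sum,
    ← abs_mul]
  refine Finset.sum_congr rfl fun u _ => Finset.sum_congr rfl fun v _ => ?_
  rw [show (0 : ZMod 2) - 1 = 1 from rfl, sub_zero, sub_zero, sub_self]
  congr 1
  ring

/-- With relative biases α and β of (a, b) and (c, d), and after division by (a + b)(c + d), the
left side is max(α, β) and the right side is α + β - αβ. -/
lemma abs_mul_sub_add_abs_mul_sub_le {a b c d : ℝ} (ha : 0 ≤ a) (hb : 0 ≤ b) (hc : 0 ≤ c)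
    (hd : 0 ≤ d) : |a * c - b * d| + |b * c - a * d| ≤
      (a + b) * |c - d| + |a - b| * (c + d) - |a - b| * |c - d| := by
  wlog hab : b ≤ a generalizing a b
  · have := this hb ha (le_of_not_ge hab)
    rw [abs_sub_comm b a, add_comm b a] at this
    linarith
  wlog hcd : d ≤ c generalizing c d
  · have := this hd hc (le_of_not_ge hcd)
    rw [abs_sub_comm d c, add_comm d c, abs_sub_comm (a * d), abs_sub_comm (b * d)] at this
    linarith
  rw [abs_of_nonneg (sub_nonneg.2 hab), abs_of_nonneg (sub_nonneg.2 hcd),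
    abs_of_nonneg (sub_nonneg.2 (mul_le_mul hab hcd hd ha))]
  rcases abs_cases (b * c - a * d) with ⟨h, -⟩ | ⟨h, -⟩ <;> rw [h] <;>
    nlinarith [mul_nonneg hb (sub_nonneg.2 hcd), mul_nonneg hd (sub_nonneg.2 hab)]

lemma bias_plus_le {w : Ω → ℝ} (hw : ∀ x, 0 ≤ w x) (h1 : ∑ x, w x = 1) (Z : Ω → ZMod 2)
    (W : Ω → S) :
    bias (fun x : Ω × Ω => w x.1 * w x.2) (fun x => Z x.2)
      (fun x => (W x.1, W x.2, Z x.1 + Z x.2)) ≤ 2 * bias w Z W - bias w Z W ^ 2 := by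
  have hn := fun b v => fiberWeight_nonneg hw (fun x => (Z x, W x)) (b, v)
  have e : 2 * bias w Z W - bias w Z W ^ 2 =
      (∑ v, (fiberWeight w (fun x => (Z x, W x)) (0, v) +
        fiberWeight w (fun x => (Z x, W x)) (1, v))) * bias w Z W + bias w Z W *
      (∑ v, (fiberWeight w (fun x => (Z x, W x)) (0, v) +
        fiberWeight w (fun x => (Z x, W x)) (1, v))) - bias w Z W * bias w Z W := by
    rw [sum_fiberWeight_add, h1]; ring
  rw [e]
  simp only [bias, fiberWeight_plus, sum_zmod_two, Fintype.sum_prod_type, Finset.sum_mul_sum,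
    ← Finset.sum_add_distrib, ← Finset.sum_sub_distrib]
  refine Finset.sum_le_sum fun u _ => Finset.sum_le_sum fun v _ => ?_
  rw [show (0 : ZMod 2) - 1 = 1 from rfl, sub_zero, sub_zero, sub_self]
  exact abs_mul_sub_add_abs_mul_sub_le (hn 0 u) (hn 1 u) (hn 0 v) (hn 1 v)

lemma fiberWeight_id (w : Ω → ℝ) (x : Ω) : fiberWeight w id x = w x := by
  classical
  simp [fiberWeight_eq_sum_ite]

/-- The law of a pair of independent copies has twice the entropy. -/
lemma ent_id_prod {w : Ω → ℝ} (h1 : ∑ x, w x = 1) :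
    ent (fun x : Ω × Ω => w x.1 * w x.2) id = 2 * ent w id := by
  simp only [ent, fiberWeight_id, Fintype.sum_prod_type, Real.negMulLog_mul, Finset.sum_add_distrib,
    ← Finset.sum_mul, ← Finset.mul_sum, h1]
  ring

end Finite

/-! ### One step of the polar recursion -/

section Polar

/-- The index `2 j + b`. -/
def childIndex (t : ℕ) : Fin (2 ^ t) × Fin 2 ≃ Fin (2 ^ (t + 1)) :=
  finProdFinEquiv.trans (finCongr (pow_succ 2 t).symm)

lemma childIndex_val (t : ℕ) (j : Fin (2 ^ t)) (b : Fin 2) :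
    (childIndex t (j, b) : ℕ) = b + 2 * j := rfl

lemma childIndex_lt_zero (t : ℕ) (a j : Fin (2 ^ t)) (c : Fin 2) :
    childIndex t (a, c) < childIndex t (j, 0) ↔ a < j := by
  rw [Fin.lt_def, Fin.lt_def, childIndex_val, childIndex_val]
  simp only [Fin.val_zero]
  omega

lemma childIndex_lt_one (t : ℕ) (a j : Fin (2 ^ t)) (c : Fin 2) :
    childIndex t (a, c) < childIndex t (j, 1) ↔ a < j ∨ (a = j ∧ c = 0) := by
  rw [Fin.lt_def, Fin.lt_def, childIndex_val, childIndex_val, Fin.ext_iff, Fin.ext_iff]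
  simp only [Fin.val_zero, Fin.val_one]
  omega

/-- The splitting of a vector into its entries of even and of odd index. -/
def splitEquiv (t : ℕ) : (Fin (2 ^ (t + 1)) → ZMod 2) ≃
    (Fin (2 ^ t) → ZMod 2) × (Fin (2 ^ t) → ZMod 2) where
  toFun x := (fun a => x (childIndex t (a, 0)), fun a => x (childIndex t (a, 1)))
  invFun y i := if ((childIndex t).symm i).2 = 0 then y.1 ((childIndex t).symm i).1
    else y.2 ((childIndex t).symm i).1
  left_inv x := by
    funext i
    obtain ⟨⟨a, b⟩, rfl⟩ := (childIndex t).surjective i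
    fin_cases b <;> simp
  right_inv y := by simp

/-- The coordinates of `x G_n`. -/
def polarTransform (t : ℕ) (x : Fin (2 ^ t) → ZMod 2) (j : Fin (2 ^ t)) : ZMod 2 :=
  Matrix.vecMul x (polarMatrix t) j

lemma polarTransform_add (t : ℕ) (x y : Fin (2 ^ t) → ZMod 2) (j : Fin (2 ^ t)) :
    polarTransform t (x + y) j = polarTransform t x j + polarTransform t y j := by
  simp [polarTransform, Matrix.add_vecMul]

lemma polarMatrix_succ_apply (t : ℕ) (a j : Fin (2 ^ t)) (b c : Fin 2) :
    polarMatrix (t + 1) (childIndex t (a, b)) (childIndex t (j, c)) =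
      polarMatrix t a j * !![1, 0; 1, 1] b c := by
  change Matrix.reindex (childIndex t) (childIndex t) _ _ _ = _
  simp

lemma polarTransform_zero (t : ℕ) (x : Fin (2 ^ (t + 1)) → ZMod 2) (j : Fin (2 ^ t)) :
    polarTransform (t + 1) x (childIndex t (j, 0)) =
      polarTransform t (splitEquiv t x).1 j + polarTransform t (splitEquiv t x).2 j := by
  simp only [polarTransform, Matrix.vecMul, dotProduct, ← Finset.sum_add_distrib]
  rw [← (childIndex t).sum_comp, Fintype.sum_prod_type]
  refine Finset.sum_congr rfl fun a _ => ?_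
  simp [polarMatrix_succ_apply, splitEquiv]

lemma polarTransform_one (t : ℕ) (x : Fin (2 ^ (t + 1)) → ZMod 2) (j : Fin (2 ^ t)) :
    polarTransform (t + 1) x (childIndex t (j, 1)) = polarTransform t (splitEquiv t x).2 j := by
  simp only [polarTransform, Matrix.vecMul, dotProduct]
  rw [← (childIndex t).sum_comp, Fintype.sum_prod_type]
  refine Finset.sum_congr rfl fun a _ => ?_
  simp [polarMatrix_succ_apply, splitEquiv]

lemma polarTransform_injective (t : ℕ) : Function.Injective (polarTransform t) := by
  induction t with
  | zero =>
    intro x y h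
    funext j
    simpa [polarTransform, polarMatrix] using congrFun h j
  | succ t ih =>
    intro x y h
    have h1 : (splitEquiv t x).2 = (splitEquiv t y).2 := ih <| by
      funext j
      simpa only [polarTransform_one] using congrFun h (childIndex t (j, 1))
    have h0 : (splitEquiv t x).1 = (splitEquiv t y).1 := ih <| by
      funext j
      have := congrFun h (childIndex t (j, 0))
      rwa [polarTransform_zero, polarTransform_zero, h1, add_left_inj] at this
    exact (splitEquiv t).injective (Prod.ext h0 h1)

/-- The coordinates of `x G_n` of index less than `j`. -/
def polarPrefix (t : ℕ) (j : Fin (2 ^ t)) (x : Fin (2 ^ t) → ZMod 2) :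
    {i : Fin (2 ^ t) // i < j} → ZMod 2 := fun i => polarTransform t x i

lemma polarPrefix_eq_iff {t : ℕ} {j : Fin (2 ^ t)} {x y : Fin (2 ^ t) → ZMod 2} :
    polarPrefix t j x = polarPrefix t j y ↔ ∀ i < j, polarTransform t x i = polarTransform t y i := by
  simp [funext_iff, polarPrefix]

/-- Each earlier pair (U_i + V_i, V_i) determines (U_i, V_i), so the past of index 2j is the pair of
pasts of the two independent halves. -/
lemma polarPrefix_zero_eq_iff {t : ℕ} {j : Fin (2 ^ t)} {x y : Fin (2 ^ (t + 1)) → ZMod 2} :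
    polarPrefix (t + 1) (childIndex t (j, 0)) x = polarPrefix (t + 1) (childIndex t (j, 0)) y ↔
      (polarPrefix t j (splitEquiv t x).1, polarPrefix t j (splitEquiv t x).2) =
        (polarPrefix t j (splitEquiv t y).1, polarPrefix t j (splitEquiv t y).2) := by
  simp only [Prod.mk.injEq, polarPrefix_eq_iff, (childIndex t).surjective.forall, Prod.forall,
    childIndex_lt_zero, Fin.forall_fin_two, polarTransform_zero, polarTransform_one]
  constructor
  · intro h
    refine ⟨fun a ha => ?_, fun a ha => (h a).2 ha⟩
    have := (h a).1 ha
    rwa [(h a).2 ha, add_left_inj] at this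
  · rintro ⟨h0, h1⟩ a
    exact ⟨fun ha => by rw [h0 a ha, h1 a ha], h1 a⟩

/-- The past of index 2j + 1 consists of the past of 2j and the coordinate 2j itself, which is U_j +
V_j. -/
lemma polarPrefix_one_eq_iff {t : ℕ} {j : Fin (2 ^ t)} {x y : Fin (2 ^ (t + 1)) → ZMod 2} :
    polarPrefix (t + 1) (childIndex t (j, 1)) x = polarPrefix (t + 1) (childIndex t (j, 1)) y ↔
      (polarPrefix t j (splitEquiv t x).1, polarPrefix t j (splitEquiv t x).2,
        polarTransform t (splitEquiv t x).1 j + polarTransform t (splitEquiv t x).2 j) =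
      (polarPrefix t j (splitEquiv t y).1, polarPrefix t j (splitEquiv t y).2,
        polarTransform t (splitEquiv t y).1 j + polarTransform t (splitEquiv t y).2 j) := by
  have h0 := polarPrefix_zero_eq_iff (j := j) (x := x) (y := y)
  rw [Prod.mk.injEq] at h0
  rw [Prod.mk.injEq, Prod.mk.injEq, ← and_assoc, ← h0, ← polarTransform_zero,
    ← polarTransform_zero]
  simp only [polarPrefix_eq_iff, (childIndex t).surjective.forall, Prod.forall,
    childIndex_lt_zero, childIndex_lt_one]
  constructor
  · exact fun h => ⟨fun a c ha => h a c (Or.inl ha), h j 0 (Or.inr ⟨rfl, rfl⟩)⟩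
  · rintro ⟨h, h'⟩ a c (ha | ⟨rfl, rfl⟩)
    exacts [h a c ha, h']

/-- The point masses of the Bernoulli(`p`) distribution on `𝔽₂`. -/
def bernoulliWeight (p : ℝ) (a : ZMod 2) : ℝ := if a = 1 then p else 1 - p

/-- The point masses of the law of independent Bernoulli(`p`) variables. -/
def productWeight {ι : Type*} [Fintype ι] (p : ℝ) (x : ι → ZMod 2) : ℝ :=
  ∏ i, bernoulliWeight p (x i)

lemma bernoulliWeight_nonneg {p : ℝ} (h0 : 0 ≤ p) (h1 : p ≤ 1) (a : ZMod 2) :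
    0 ≤ bernoulliWeight p a := by
  unfold bernoulliWeight; split_ifs <;> linarith

lemma productWeight_nonneg {ι : Type*} [Fintype ι] {p : ℝ} (h0 : 0 ≤ p) (h1 : p ≤ 1)
    (x : ι → ZMod 2) : 0 ≤ productWeight p x :=
  Finset.prod_nonneg fun _ _ => bernoulliWeight_nonneg h0 h1 _

lemma sum_productWeight (ι : Type*) [Fintype ι] [DecidableEq ι] (p : ℝ) :
    ∑ x : ι → ZMod 2, productWeight p x = 1 := by
  have := Finset.prod_univ_sum (fun _ : ι => (Finset.univ : Finset (ZMod 2)))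
    (fun _ a => bernoulliWeight p a)
  rw [Fintype.piFinset_univ] at this
  simp only [productWeight, ← this]
  refine Finset.prod_eq_one fun i _ => ?_
  rw [sum_zmod_two]
  simp [bernoulliWeight]

lemma productWeight_split (t : ℕ) (p : ℝ) (x : Fin (2 ^ (t + 1)) → ZMod 2) :
    productWeight p x =
      productWeight p (splitEquiv t x).1 * productWeight p (splitEquiv t x).2 := by
  simp only [productWeight, ← Finset.prod_mul_distrib]
  rw [← (childIndex t).prod_comp, Fintype.prod_prod_type]
  simp [splitEquiv]

/-- The conditional entropy of `Y_j` given `Y^{j-1}`, in nats. -/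
noncomputable def polarEnt (p : ℝ) (t : ℕ) (j : Fin (2 ^ t)) : ℝ :=
  condEnt (productWeight p) (fun x => polarTransform t x j) (polarPrefix t j)

/-- The expected conditional bias of `Y_j` given `Y^{j-1}`. -/
noncomputable def polarBias (p : ℝ) (t : ℕ) (j : Fin (2 ^ t)) : ℝ :=
  bias (productWeight p) (fun x => polarTransform t x j) (polarPrefix t j)

lemma polarBias_zero (p : ℝ) (t : ℕ) (j : Fin (2 ^ t)) :
    polarBias p (t + 1) (childIndex t (j, 0)) = polarBias p t j ^ 2 := by
  rw [polarBias, polarBias, ← bias_minus]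
  exact bias_eq_of_equiv (splitEquiv t) (productWeight_split t p)
    (fun x => polarTransform_zero t x j) fun x y => polarPrefix_zero_eq_iff

lemma polarBias_one_le {p : ℝ} (h0 : 0 ≤ p) (h1 : p ≤ 1) (t : ℕ) (j : Fin (2 ^ t)) :
    polarBias p (t + 1) (childIndex t (j, 1)) ≤ 2 * polarBias p t j - polarBias p t j ^ 2 := by
  refine le_trans (le_of_eq ?_) (bias_plus_le (productWeight_nonneg h0 h1) (sum_productWeight _ p)
    (fun x => polarTransform t x j) (polarPrefix t j))
  exact bias_eq_of_equiv (splitEquiv t) (productWeight_split t p)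
    (fun x => polarTransform_one t x j) fun x y => polarPrefix_one_eq_iff

lemma ent_productWeight (p : ℝ) (t : ℕ) :
    ent (productWeight p : (Fin (2 ^ t) → ZMod 2) → ℝ) id = 2 ^ t * Real.binEntropy p := by
  induction t with
  | zero =>
    have e : ∀ x : Fin (2 ^ 0) → ZMod 2, productWeight p x =
        bernoulliWeight p (Equiv.funUnique (Fin 1) (ZMod 2) x) := fun x => Fin.prod_univ_one _
    rw [ent_eq_of_equiv (Equiv.funUnique (Fin 1) (ZMod 2)) (Z' := id) (Z := id) e
      fun x y => (Equiv.funUnique (Fin 1) (ZMod 2)).injective.eq_iff.symm]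
    simp only [ent, fiberWeight_id, sum_zmod_two]
    simp [bernoulliWeight, Real.binEntropy_eq_negMulLog_add_negMulLog_one_sub, add_comm]
  | succ t ih =>
    rw [ent_eq_of_equiv (splitEquiv t) (Z' := id) (Z := id)
      (w := fun y => productWeight p y.1 * productWeight p y.2) (productWeight_split t p)
      fun x y => (splitEquiv t).injective.eq_iff.symm,
      ent_id_prod (sum_productWeight _ p), ih]
    ring

end Polar

/-! ### Chain rules -/

section Chain

variable {Ω : Type*} [Fintype Ω] {m : ℕ}

lemma ent_insert (w : Ω → ℝ) (Y : Ω → Fin m → ZMod 2) {a : Fin m} (S : Finset (Fin m)) :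
    ent w (fun x (i : ↥(insert a S)) => Y x i) =
      ent w (fun x (i : S) => Y x i) + condEnt w (fun x => Y x a) (fun x (i : S) => Y x i) := by
  rw [← ent_pair]
  exact ent_congr w fun x y => by simp [funext_iff]

/-- The chain rule, for the entropy of a subset of the coordinates. -/
lemma sum_condEnt_le_ent {w : Ω → ℝ} (hw : ∀ x, 0 ≤ w x) (h1 : ∑ x, w x = 1)
    (Y : Ω → Fin m → ZMod 2) (S : Finset (Fin m)) :
    ∑ j ∈ S, condEnt w (fun x => Y x j) (fun x (i : {i : Fin m // i < j}) => Y x i) ≤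
      ent w (fun x (i : S) => Y x i) := by
  induction S using Finset.induction_on_max with
  | empty =>
    rw [Finset.sum_empty, ent]
    refine Finset.sum_nonneg fun s _ => Real.negMulLog_nonneg (fiberWeight_nonneg hw _ _) ?_
    rw [← h1, ← sum_fiberWeight w (fun x (i : (∅ : Finset (Fin m))) => Y x i)]
    exact Finset.single_le_sum (f := fiberWeight w _) (fun s _ => fiberWeight_nonneg hw _ s)
      (Finset.mem_univ s)
  | insert a S hS ih =>
    -- All of `S` lies below `a`, so conditioning on `S` alone is conditioning on less than the full
    -- past of `a`.
    rw [Finset.sum_insert fun h => (hS a h).false, ent_insert, add_comm]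
    refine add_le_add ih (condEnt_le_of_refines hw _ fun x y h => ?_)
    funext i
    exact congrFun h ⟨i, hS i i.2⟩

/-- The chain rule, for an initial segment of the coordinates. -/
lemma sum_condEnt_eq_ent {w : Ω → ℝ} (h1 : ∑ x, w x = 1)
    (Y : Ω → Fin m → ZMod 2) (S : Finset (Fin m)) (hS : ∀ j ∈ S, ∀ i < j, i ∈ S) :
    ∑ j ∈ S, condEnt w (fun x => Y x j) (fun x (i : {i : Fin m // i < j}) => Y x i) =
      ent w (fun x (i : S) => Y x i) := by
  induction S using Finset.induction_on_max with
  | empty =>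
    rw [Finset.sum_empty, ent, Fintype.sum_unique, ← Fintype.sum_unique (fiberWeight w _),
      sum_fiberWeight, h1, Real.negMulLog_one]
  | insert a S ha ih =>
    have hlt : ∀ i, i < a ↔ i ∈ S := fun i => ⟨fun hi =>
      (Finset.mem_insert.1 (hS a (Finset.mem_insert_self a S) i hi)).resolve_left hi.ne, ha i⟩
    rw [Finset.sum_insert fun h => (ha a h).false, ent_insert, add_comm, ih]
    · congr 1
      exact condEnt_congr w _ fun x y => by simp [funext_iff, hlt]
    · intro j hj i hi
      exact (hlt i).1 (hi.trans (ha j hj))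

end Chain

/-! ### Monotonicity of the conditional entropies in the source -/

section Polar

lemma sum_polarEnt (p : ℝ) (t : ℕ) : ∑ j, polarEnt p t j = 2 ^ t * Real.binEntropy p := by
  rw [← ent_productWeight]
  refine (sum_condEnt_eq_ent (sum_productWeight _ p) (polarTransform t) Finset.univ
    (by simp)).trans (ent_congr _ fun x y => ?_)
  refine Iff.trans ?_ (polarTransform_injective t).eq_iff
  simp [funext_iff]

lemma bernoulliWeight_convolution (q r : ℝ) (a : ZMod 2) :
    bernoulliWeight (q + r * (1 - 2 * q)) a = ∑ c, bernoulliWeight r c * bernoulliWeight q (a + c) := by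
  rw [sum_zmod_two]
  obtain rfl | rfl : a = 0 ∨ a = 1 := by revert a; decide
  · simp [bernoulliWeight]; ring
  · simp [bernoulliWeight, show (1 : ZMod 2) + 1 = 0 from rfl]; ring

lemma productWeight_convolution {ι : Type*} [Fintype ι] [DecidableEq ι] (q r : ℝ)
    (x : ι → ZMod 2) : productWeight (q + r * (1 - 2 * q)) x =
      ∑ n : ι → ZMod 2, productWeight r n * productWeight q (x + n) := by
  have := Finset.prod_univ_sum (fun _ : ι => (Finset.univ : Finset (ZMod 2)))
    (fun i c => bernoulliWeight r c * bernoulliWeight q (x i + c))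
  rw [Fintype.piFinset_univ] at this
  simp only [productWeight, bernoulliWeight_convolution, this, Finset.prod_mul_distrib,
    Pi.add_apply]

/-- By linearity, translating the input adds constants to `Y_j` and to its past; the former permutes
the two masses, the latter relabels the cells. -/
lemma condEnt_translate (t : ℕ) (w : (Fin (2 ^ t) → ZMod 2) → ℝ) (j : Fin (2 ^ t))
    (n : Fin (2 ^ t) → ZMod 2) :
    condEnt (fun x => w (x + n)) (fun x => polarTransform t x j) (polarPrefix t j) =
      condEnt w (fun x => polarTransform t x j) (polarPrefix t j) := by
  rw [← condEnt_add_const w _ _ (polarTransform t n j)]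
  refine condEnt_eq_of_equiv (Equiv.addRight n) (fun x => rfl) (fun x => ?_) fun x y => ?_
  · simp only [Equiv.coe_addRight, polarTransform_add, add_assoc, CharTwo.add_self_eq_zero,
      add_zero]
  · simp [polarPrefix_eq_iff, polarTransform_add]

/-- Adding independent Bernoulli noise does not decrease the conditional entropies. -/
lemma polarEnt_le_convolution {q r : ℝ} (hq0 : 0 ≤ q) (hq1 : q ≤ 1) (hr0 : 0 ≤ r) (hr1 : r ≤ 1)
    (t : ℕ) (j : Fin (2 ^ t)) : polarEnt q t j ≤ polarEnt (q + r * (1 - 2 * q)) t j := by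
  have := sum_mul_condEnt_le (productWeight r) (productWeight_nonneg hr0 hr1)
    (fun (n x : Fin (2 ^ t) → ZMod 2) => productWeight q (x + n))
    (fun n x => productWeight_nonneg hq0 hq1 _) (fun x => polarTransform t x j) (polarPrefix t j)
  simp only [condEnt_translate, ← Finset.sum_mul, sum_productWeight, one_mul,
    ← productWeight_convolution] at this
  exact this

lemma abs_le_of_binEntropy_le {p q : ℝ} (hp0 : 0 ≤ p) (hp1 : p ≤ 1) (hq0 : 0 ≤ q) (hq1 : q ≤ 1)
    (h : Real.binEntropy q ≤ Real.binEntropy p) : |1 - 2 * p| ≤ |1 - 2 * q| := by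
  wlog hp : p ≤ 2⁻¹ generalizing p
  · have := this (p := 1 - p) (by linarith) (by linarith) (by simpa using h)
      (by norm_num at hp ⊢; linarith)
    rwa [show 1 - 2 * (1 - p) = -(1 - 2 * p) by ring, abs_neg] at this
  wlog hq : q ≤ 2⁻¹ generalizing q
  · have := this (q := 1 - q) (by linarith) (by linarith) (by simpa using h)
      (by norm_num at hq ⊢; linarith)
    rwa [show 1 - 2 * (1 - q) = -(1 - 2 * q) by ring, abs_neg] at this
  have := (Real.binEntropy_strictMonoOn.le_iff_le ⟨hq0, hq⟩ ⟨hp0, hp⟩).1 h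
  norm_num at hp hq
  rw [abs_of_nonneg (by linarith), abs_of_nonneg (by linarith)]
  linarith

lemma polarEnt_mono {p q : ℝ} (hp0 : 0 ≤ p) (hp1 : p ≤ 1) (hq0 : 0 ≤ q) (hq1 : q ≤ 1)
    (h : Real.binEntropy q ≤ Real.binEntropy p) (t : ℕ) (j : Fin (2 ^ t)) :
    polarEnt q t j ≤ polarEnt p t j := by
  have habs := abs_le_of_binEntropy_le hp0 hp1 hq0 hq1 h
  rcases eq_or_ne (1 - 2 * q) 0 with h0 | h0
  · rw [h0, abs_zero, abs_nonpos_iff] at habs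
    rw [show p = q by linarith]
  · have hr : |(1 - 2 * p) / (1 - 2 * q)| ≤ 1 := by
      rw [abs_div, div_le_one (abs_pos.2 h0)]; exact habs
    rw [abs_le] at hr
    -- Noise multiplies 1 - 2q by 1 - 2r, so r is chosen with 1 - 2r = (1 - 2p)/(1 - 2q); this is a
    -- probability because the quotient lies in [-1, 1].
    have := polarEnt_le_convolution hq0 hq1 (r := (1 - (1 - 2 * p) / (1 - 2 * q)) / 2)
      (by linarith) (by linarith) t j
    have e : q + (1 - (1 - 2 * p) / (1 - 2 * q)) / 2 * (1 - 2 * q) =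
        q + (1 - 2 * q - (1 - 2 * p) / (1 - 2 * q) * (1 - 2 * q)) / 2 := by ring
    rw [e, div_mul_cancel₀ _ h0] at this
    convert this using 1
    congr 1
    ring

end Polar

/-! ### Polarization of biases by a fourth-root potential -/

section BiasTree

/-- The fourth root, the potential function of the polarization process. -/
noncomputable def qroot (x : ℝ) : ℝ := √√x

lemma qroot_nonneg (x : ℝ) : 0 ≤ qroot x := Real.sqrt_nonneg _

lemma qroot_mono {x y : ℝ} (h : x ≤ y) : qroot x ≤ qroot y :=
  Real.sqrt_le_sqrt (Real.sqrt_le_sqrt h)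

lemma qroot_pow {x : ℝ} (h : 0 ≤ x) : qroot x ^ 4 = x := by
  rw [show 4 = 2 * 2 from rfl, pow_mul, qroot, Real.sq_sqrt (Real.sqrt_nonneg _), Real.sq_sqrt h]

lemma qroot_mul {x : ℝ} (h : 0 ≤ x) (y : ℝ) : qroot (x * y) = qroot x * qroot y := by
  rw [qroot, Real.sqrt_mul h, Real.sqrt_mul (Real.sqrt_nonneg _)]; rfl

lemma qroot_sq {x : ℝ} (h : 0 ≤ x) : qroot (x ^ 2) = qroot x ^ 2 := by
  rw [sq, qroot_mul h, sq]

lemma qroot_le_one {x : ℝ} (h : x ≤ 1) : qroot x ≤ 1 := by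
  simpa [qroot] using qroot_mono h

lemma continuous_qroot : Continuous qroot := by unfold qroot; fun_prop

lemma qroot_two_le : qroot 2 ≤ 6 / 5 := by
  have h := qroot_pow (x := 2) (by norm_num)
  by_contra! hlt
  have := pow_lt_pow_left₀ hlt (by norm_num) (n := 4) (by norm_num)
  norm_num at this
  linarith

/-- The potential decreases strictly on average, away from the fixed points. -/
lemma qroot_drift_pos {x : ℝ} (h0 : 0 < x) (h1 : x < 1) :
    0 < 2 * qroot x - (qroot (x ^ 2) + qroot (2 * x - x ^ 2)) := by
  rw [qroot_sq h0.le, show 2 * x - x ^ 2 = x * (2 - x) by ring, qroot_mul h0.le]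
  have hs : 0 < qroot x := Real.sqrt_pos.2 (Real.sqrt_pos.2 h0)
  set s := qroot x
  set r := qroot (2 - x)
  have hs4 : s ^ 4 = x := qroot_pow h0.le
  have hr4 : r ^ 4 = 2 - x := qroot_pow (by linarith)
  have hr : 0 ≤ r := qroot_nonneg _
  -- Strict power-mean inequality: s⁴ + r⁴ = 2 with s ≠ r. The drift is s(2 - s - r).
  have : s + r < 2 := by
    by_contra! h
    have hsr : s ≠ r := by
      intro e
      rw [← e, hs4] at hr4
      linarith
    have hd : 0 < (s - r) ^ 2 := by
      have := sub_ne_zero.2 hsr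
      positivity
    have h2 : 2 < s ^ 2 + r ^ 2 := by nlinarith
    nlinarith [sq_nonneg (s ^ 2 - r ^ 2)]
  nlinarith

lemma exists_qroot_drift {γ : ℝ} (hγ : 0 < γ) : ∃ κ > 0, ∀ x ∈ Set.Icc γ (1 - γ),
    κ ≤ 2 * qroot x - (qroot (x ^ 2) + qroot (2 * x - x ^ 2)) := by
  rcases (Set.Icc γ (1 - γ)).eq_empty_or_nonempty with h | h
  · exact ⟨1, one_pos, by simp [h]⟩
  · have hc : Continuous fun x => 2 * qroot x - (qroot (x ^ 2) + qroot (2 * x - x ^ 2)) := by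
      unfold qroot; fun_prop
    obtain ⟨y, hy, hmin⟩ := isCompact_Icc.exists_isMinOn h hc.continuousOn
    exact ⟨_, qroot_drift_pos (hγ.trans_le hy.1) (by linarith [hy.2]), fun x hx => hmin hx⟩

lemma qroot_drift_nonneg {x : ℝ} (h0 : 0 ≤ x) (h1 : x ≤ 1) :
    0 ≤ 2 * qroot x - (qroot (x ^ 2) + qroot (2 * x - x ^ 2)) := by
  rcases h0.eq_or_lt with rfl | h0
  · simp [qroot]
  rcases h1.eq_or_lt with rfl | h1
  · norm_num [qroot]
  · exact (qroot_drift_pos h0 h1).le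

/-- A family of numbers indexed by the nodes of the binary tree, which evolves like the conditional
biases of the polar transform. -/
structure IsBiasTree (b : (t : ℕ) → Fin (2 ^ t) → ℝ) : Prop where
  nonneg : ∀ t j, 0 ≤ b t j
  le_one : ∀ t j, b t j ≤ 1
  zero : ∀ t j, b (t + 1) (childIndex t (j, 0)) = b t j ^ 2
  one_le : ∀ t j, b (t + 1) (childIndex t (j, 1)) ≤ 2 * b t j - b t j ^ 2

lemma isBiasTree_polarBias {p : ℝ} (h0 : 0 ≤ p) (h1 : p ≤ 1) : IsBiasTree (polarBias p) where
  nonneg _ _ := bias_nonneg _ _ _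
  le_one _ _ := bias_le_one (productWeight_nonneg h0 h1) (sum_productWeight _ p) _ _
  zero := polarBias_zero p
  one_le := polarBias_one_le h0 h1

/-- The average of `f` over a level of the tree. -/
noncomputable def levelAvg (b : (t : ℕ) → Fin (2 ^ t) → ℝ) (f : ℝ → ℝ) (t : ℕ) : ℝ :=
  (∑ j, f (b t j)) / 2 ^ t

variable {b : (t : ℕ) → Fin (2 ^ t) → ℝ}

lemma levelAvg_le_of_le {f g : ℝ → ℝ} {t : ℕ} (h : ∀ j, f (b t j) ≤ g (b t j)) :
    levelAvg b f t ≤ levelAvg b g t :=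
  div_le_div_of_nonneg_right (Finset.sum_le_sum fun j _ => h j) (by positivity)

lemma levelAvg_const (c : ℝ) (t : ℕ) : levelAvg b (fun _ => c) t = c := by
  simp [levelAvg]

lemma levelAvg_add (f g : ℝ → ℝ) (t : ℕ) :
    levelAvg b (fun x => f x + g x) t = levelAvg b f t + levelAvg b g t := by
  simp [levelAvg, Finset.sum_add_distrib, add_div]

lemma levelAvg_mul (c : ℝ) (f : ℝ → ℝ) (t : ℕ) :
    levelAvg b (fun x => c * f x) t = c * levelAvg b f t := by
  simp [levelAvg, ← Finset.mul_sum, mul_div_assoc]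

lemma IsBiasTree.levelAvg_succ_le (hb : IsBiasTree b) {f : ℝ → ℝ} (hf : Monotone f) (t : ℕ) :
    levelAvg b f (t + 1) ≤ levelAvg b (fun x => (f (x ^ 2) + f (2 * x - x ^ 2)) / 2) t := by
  rw [levelAvg, levelAvg, ← (childIndex t).sum_comp, Fintype.sum_prod_type, ← Finset.sum_div,
    div_div, ← pow_succ']
  refine div_le_div_of_nonneg_right (Finset.sum_le_sum fun j _ => ?_) (by positivity)
  rw [Fin.sum_univ_two, hb.zero]
  exact add_le_add_right (hf (hb.one_le t j)) _

open Classical in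
/-- Polarization: some early level has few biases that are bounded away from `0` and `1`. -/
lemma exists_level_polarized {γ δ : ℝ} (hγ : 0 < γ) (hδ : 0 < δ) : ∃ N : ℕ,
    ∀ b : (t : ℕ) → Fin (2 ^ t) → ℝ, IsBiasTree b →
      ∃ t < N, levelAvg b (fun x => if x ∈ Set.Icc γ (1 - γ) then 1 else 0) t ≤ δ := by
  obtain ⟨κ, hκ, hdrift⟩ := exists_qroot_drift hγ
  -- The average potential starts at most 1 and stays nonnegative, while every unpolarized level
  -- costs it more than κδ/2.
  obtain ⟨N, hN⟩ := exists_nat_gt (1 / (κ / 2 * δ))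
  refine ⟨N, fun b hb => ?_⟩
  by_contra! hcon
  have step : ∀ t, levelAvg b qroot (t + 1) + κ / 2 *
      levelAvg b (fun x => if x ∈ Set.Icc γ (1 - γ) then 1 else 0) t ≤ levelAvg b qroot t := by
    intro t
    rw [← levelAvg_mul]
    refine (add_le_add_left (hb.levelAvg_succ_le (fun x y => qroot_mono) t) _).trans ?_
    rw [← levelAvg_add]
    refine levelAvg_le_of_le fun j => ?_
    split_ifs with h
    · linarith [hdrift _ h]
    · linarith [qroot_drift_nonneg (hb.nonneg t j) (hb.le_one t j)]
  have ind : ∀ t ≤ N, levelAvg b qroot t + t * (κ / 2 * δ) ≤ 1 := by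
    intro t
    induction t with
    | zero =>
      intro _
      have : levelAvg b qroot 0 ≤ levelAvg b (fun _ => 1) 0 :=
        levelAvg_le_of_le fun j => qroot_le_one (hb.le_one 0 j)
      rw [levelAvg_const] at this
      simpa using this
    | succ t ih =>
      intro ht
      have h1 := ih (by omega)
      have h2 := mul_le_mul_of_nonneg_left (hcon t (by omega)).le (half_pos hκ).le
      have h3 := step t
      push_cast
      linarith
  have h1 := ind N le_rfl
  have h2 : 0 ≤ levelAvg b qroot N := by
    have := levelAvg_le_of_le (b := b) (f := fun _ => 0) (g := qroot) (t := N)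
      fun j => qroot_nonneg _
    rwa [levelAvg_const] at this
  rw [div_lt_iff₀ (by positivity)] at hN
  linarith

/-- The potential that controls the fraction of descendants whose fourth root exceeds `a`. -/
noncomputable def exceedBound (a : ℝ) (s : ℕ) (x : ℝ) : ℝ :=
  min 1 (10 / 3 * qroot x + (3 / 4) ^ s * qroot x / a)

lemma exceedBound_mono {a : ℝ} (ha : 0 < a) (s : ℕ) : Monotone (exceedBound a s) := by
  intro x y h
  have := qroot_mono h
  unfold exceedBound
  gcongr

/-- If the fourth root s of x is at least 3/10, the bound is 1 and nothing is to be shown. Otherwise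
the fourth roots at the children are at most s² ≤ (3/10)s and 2^{1/4} s ≤ (6/5)s, whose average is
at most (3/4)s. Truncation at 1 makes the first case free. -/
lemma exceedBound_step {a : ℝ} (ha : 0 < a) (s : ℕ) {x : ℝ} (h0 : 0 ≤ x) :
    (exceedBound a s (x ^ 2) + exceedBound a s (2 * x - x ^ 2)) / 2 ≤ exceedBound a (s + 1) x := by
  have hq := qroot_nonneg x
  refine le_min ?_ ?_
  · have h1 : exceedBound a s (x ^ 2) ≤ 1 := min_le_left _ _
    have h2 : exceedBound a s (2 * x - x ^ 2) ≤ 1 := min_le_left _ _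
    linarith
  have hnn : 0 ≤ (3 / 4) ^ (s + 1) * qroot x / a := by positivity
  rcases le_total (3 / 10) (qroot x) with h | h
  · have h1 : exceedBound a s (x ^ 2) ≤ 1 := min_le_left _ _
    have h2 : exceedBound a s (2 * x - x ^ 2) ≤ 1 := min_le_left _ _
    linarith
  · have h1 : exceedBound a s (x ^ 2) ≤ (10 / 3 + (3 / 4) ^ s / a) * (3 / 10 * qroot x) := by
      refine (min_le_right _ _).trans ?_
      rw [qroot_sq h0, mul_div_right_comm, ← add_mul]
      gcongr
      nlinarith
    have h2 : exceedBound a s (2 * x - x ^ 2) ≤ (10 / 3 + (3 / 4) ^ s / a) * (6 / 5 * qroot x) := by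
      refine (min_le_right _ _).trans ?_
      rw [mul_div_right_comm, ← add_mul]
      gcongr
      refine (qroot_mono (show 2 * x - x ^ 2 ≤ 2 * x by nlinarith)).trans ?_
      rw [qroot_mul (by norm_num)]
      exact mul_le_mul_of_nonneg_right qroot_two_le hq
    have e : 10 / 3 * qroot x + (3 / 4) ^ (s + 1) * qroot x / a =
        (10 / 3 + (3 / 4) ^ s / a) * (3 / 4 * qroot x) + 10 / 3 * (qroot x / 4) := by
      rw [pow_succ]; ring
    rw [e]
    linarith

lemma IsBiasTree.levelAvg_exceedBound_le (hb : IsBiasTree b) {a : ℝ} (ha : 0 < a) (t s : ℕ) :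
    levelAvg b (exceedBound a 0) (t + s) ≤ levelAvg b (exceedBound a s) t := by
  induction s generalizing t with
  | zero => exact le_rfl
  | succ s ih =>
    rw [add_comm s 1, ← add_assoc]
    refine (ih (t + 1)).trans ((hb.levelAvg_succ_le (exceedBound_mono ha s) t).trans ?_)
    rw [add_comm 1 s]
    exact levelAvg_le_of_le fun j => exceedBound_step ha s (hb.nonneg t j)

lemma one_le_exceedBound_zero {a x : ℝ} (ha : 0 < a) (h : a ≤ qroot x) :
    1 ≤ exceedBound a 0 x := by
  have := qroot_nonneg x
  refine le_min le_rfl ?_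
  rw [pow_zero, one_mul]
  have := (one_le_div ha).2 h
  linarith

lemma exceedBound_nonneg {a : ℝ} (ha : 0 < a) (s : ℕ) (x : ℝ) : 0 ≤ exceedBound a s x := by
  have := qroot_nonneg x
  exact le_min zero_le_one (by positivity)

/-- The decay rate of the potential beats the required rate `2 ^ (-t)` of the biases. -/
lemma tendsto_rate {c : ℝ} (hc : 0 < c) :
    Filter.Tendsto (fun t : ℕ => (3 / 4) ^ t / qroot (c / 2 ^ t)) Filter.atTop (nhds 0) := by
  have e : ∀ t : ℕ, (3 / 4 : ℝ) ^ t / qroot (c / 2 ^ t) = (3 / 4 * qroot 2) ^ t * (qroot c)⁻¹ := by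
    intro t
    have h2 : qroot 2 ≠ 0 := fun h => by
      have := qroot_pow (x := 2) (by norm_num)
      norm_num [h] at this
    have h1 : qroot (c / 2 ^ t) * qroot 2 ^ t = qroot c := by
      have hp : qroot ((2 : ℝ) ^ t) = qroot 2 ^ t := by
        induction t with
        | zero => simp [qroot]
        | succ t ih => rw [pow_succ, qroot_mul (by positivity), ih, pow_succ]
      rw [← hp, ← qroot_mul (by positivity), div_mul_cancel₀ _ (by positivity)]
    have h3 : qroot (c / 2 ^ t) ≠ 0 := by
      intro h
      rw [h, zero_mul] at h1
      have := qroot_pow hc.le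
      rw [← h1] at this
      norm_num at this
      exact hc.ne this
    rw [← h1, mul_pow]
    field_simp
  simp only [e]
  -- The ratio is below 1, as 3/4 · 6/5 = 9/10.
  have h := qroot_two_le
  have h0 := qroot_nonneg 2
  simpa using (tendsto_pow_atTop_nhds_zero_of_lt_one (r := 3 / 4 * qroot 2) (by positivity)
    (by linarith)).mul_const (qroot c)⁻¹

end BiasTree

/-! ### Polarization with a rate, uniformly in the source -/

section Polarization

lemma exists_small_gap {δ : ℝ} (hδ : 0 < δ) : ∃ γ : ℝ, 0 < γ ∧ γ ≤ 1 ∧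
    Real.binEntropy (γ / 2) / Real.log 2 ≤ δ ∧ 10 / 3 * qroot γ ≤ δ := by
  have h1 : Filter.Tendsto (fun γ : ℝ => Real.binEntropy (γ / 2) / Real.log 2)
      (nhdsWithin 0 (Set.Ioi 0)) (nhds 0) := by
    have : Continuous fun γ : ℝ => Real.binEntropy (γ / 2) / Real.log 2 := by fun_prop
    simpa using (this.tendsto 0).mono_left nhdsWithin_le_nhds
  have h2 : Filter.Tendsto (fun γ : ℝ => 10 / 3 * qroot γ)
      (nhdsWithin 0 (Set.Ioi 0)) (nhds 0) := by
    have : Continuous fun γ : ℝ => 10 / 3 * qroot γ := continuous_const.mul continuous_qroot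
    simpa [qroot] using (this.tendsto 0).mono_left nhdsWithin_le_nhds
  obtain ⟨γ, hγ, hγ1, hγ2⟩ := ((h1.eventually_le_const hδ).and ((h2.eventually_le_const hδ).and
    (Ioc_mem_nhdsGT zero_lt_one))).exists
  exact ⟨γ, hγ2.1, hγ2.2, hγ, hγ1⟩

-- Near bias 0 the exceedance bound is small and the entropy at most 1; near bias 1 the roles are
-- exchanged; in between both are at most 1. Averaged over a level, this bounds the exceeding
-- fraction by 1 - h(p) plus errors.
open Classical in
lemma exceedBound_add_binEntropy_le {a γ x : ℝ} (ha : 0 < a) (hγ : 0 < γ) (hγ1 : γ ≤ 1) (s : ℕ)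
    (h1 : x ≤ 1) : exceedBound a s x + Real.binEntropy ((1 - x) / 2) / Real.log 2 ≤
      1 + (if x ∈ Set.Icc γ (1 - γ) then 1 else 0) + (Real.binEntropy (γ / 2) / Real.log 2 +
        (10 / 3 * qroot γ + (3 / 4) ^ s / a)) := by
  have hlog : 0 < Real.log 2 := Real.log_pos one_lt_two
  have he : exceedBound a s x ≤ 1 := min_le_left _ _
  have hB : Real.binEntropy ((1 - x) / 2) / Real.log 2 ≤ 1 := by
    rw [div_le_one hlog]; exact Real.binEntropy_le_log_two
  have hG : 0 ≤ Real.binEntropy (γ / 2) / Real.log 2 :=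
    div_nonneg (Real.binEntropy_nonneg (by linarith) (by linarith)) hlog.le
  have hK1 : 0 ≤ 10 / 3 * qroot γ := mul_nonneg (by norm_num) (qroot_nonneg γ)
  have hK2 : 0 ≤ (3 / 4) ^ s / a := by positivity
  split_ifs with h
  · linarith
  · rcases lt_or_ge x γ with hx | hx
    · have : exceedBound a s x ≤ 10 / 3 * qroot γ + (3 / 4) ^ s / a := by
        refine (min_le_right _ _).trans (add_le_add ?_ ?_)
        · exact mul_le_mul_of_nonneg_left (qroot_mono hx.le) (by norm_num)
        · refine div_le_div_of_nonneg_right (mul_le_of_le_one_right (by positivity) ?_) ha.le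
          exact qroot_le_one h1
      linarith
    · have hx' : 1 - γ < x := not_le.1 fun h' => h ⟨hx, h'⟩
      have : Real.binEntropy ((1 - x) / 2) / Real.log 2 ≤
          Real.binEntropy (γ / 2) / Real.log 2 := by
        refine div_le_div_of_nonneg_right (Real.binEntropy_strictMonoOn.monotoneOn
          ⟨by linarith, by norm_num; linarith⟩ ⟨by linarith, by norm_num; linarith⟩
          (by linarith)) hlog.le
      linarith

lemma binEntropy_div_le_levelAvg {p : ℝ} (h0 : 0 ≤ p) (h1 : p ≤ 1) (t : ℕ) :
    Real.binEntropy p / Real.log 2 ≤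
      levelAvg (polarBias p) (fun x => Real.binEntropy ((1 - x) / 2) / Real.log 2) t := by
  rw [levelAvg, ← Finset.sum_div, div_right_comm]
  refine div_le_div_of_nonneg_right ?_ (Real.log_nonneg one_le_two)
  rw [le_div_iff₀ (by positivity), mul_comm, ← sum_polarEnt]
  exact Finset.sum_le_sum fun j _ => condEnt_le_binEntropy (productWeight_nonneg h0 h1)
    (sum_productWeight _ p) _ _

open Classical in
/-- Polarization with a rate: the fraction of indices whose bias is below `c / n` is at least the
entropy of the source, up to an error that vanishes uniformly in the source. -/
theorem exists_level_small_bias {c δ : ℝ} (hc : 0 < c) (hδ : 0 < δ) : ∃ T : ℕ, ∀ t ≥ T, ∀ p : ℝ,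
    0 ≤ p → p ≤ 1 → Real.binEntropy p / Real.log 2 - δ ≤
      levelAvg (polarBias p) (fun x => if x ≤ c / 2 ^ t then 1 else 0) t := by
  -- Four errors share δ: entropy near bias 1, initial potential near bias 0, unpolarized indices,
  -- and the decay term.
  obtain ⟨γ, hγ, hγ1, hγ2, hγ3⟩ := exists_small_gap (δ := δ / 4) (by linarith)
  obtain ⟨N, hN⟩ := exists_level_polarized hγ (δ := δ / 4) (by linarith)
  have hrate := (tendsto_rate hc).mul_const ((4 / 3 : ℝ) ^ N)
  rw [zero_mul] at hrate
  obtain ⟨T, hT⟩ := Filter.eventually_atTop.1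
    (hrate.eventually_le_const (show 0 < δ / 4 by linarith))
  refine ⟨max T N, fun t ht p h0 h1 => ?_⟩
  have hb := isBiasTree_polarBias h0 h1
  obtain ⟨t₀, ht₀, hmid⟩ := hN _ hb
  obtain ⟨s, rfl⟩ := Nat.exists_eq_add_of_le (ht₀.le.trans ((le_max_right T N).trans ht))
  set a := qroot (c / 2 ^ (t₀ + s)) with ha_def
  have ha : 0 < a := Real.sqrt_pos.2 (Real.sqrt_pos.2 (by positivity))
  -- The polarized level t₀ depends on the source, but t₀ < N, so the steps lost before it cost at
  -- most a factor (4/3)^N, which `hrate` absorbs.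
  have hs : (3 / 4 : ℝ) ^ s / a ≤ δ / 4 := by
    refine le_trans ?_ (hT (t₀ + s) ((le_max_left T N).trans ht))
    rw [← ha_def, pow_add, div_mul_eq_mul_div]
    refine div_le_div_of_nonneg_right ?_ ha.le
    have e : (3 / 4 : ℝ) ^ t₀ * (4 / 3) ^ t₀ = 1 := by rw [← mul_pow]; norm_num
    have e2 : (4 / 3 : ℝ) ^ t₀ ≤ (4 / 3) ^ N := pow_le_pow_right₀ (by norm_num) ht₀.le
    calc (3 / 4 : ℝ) ^ s = (3 / 4) ^ t₀ * (3 / 4) ^ s * (4 / 3) ^ t₀ := by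
          rw [mul_right_comm, e, one_mul]
      _ ≤ _ := mul_le_mul_of_nonneg_left e2 (by positivity)
  -- With no steps left, `exceedBound` is at least the indicator of a bias above the threshold.
  have hind : 1 - levelAvg (polarBias p) (exceedBound a 0) (t₀ + s) ≤
      levelAvg (polarBias p) (fun x => if x ≤ c / 2 ^ (t₀ + s) then 1 else 0) (t₀ + s) := by
    rw [sub_le_iff_le_add, ← levelAvg_add]
    refine (levelAvg_const (b := polarBias p) 1 (t₀ + s)).symm.trans_le ?_
    refine levelAvg_le_of_le fun j => ?_
    split_ifs with h
    · linarith [exceedBound_nonneg ha 0 (polarBias p (t₀ + s) j)]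
    · linarith [one_le_exceedBound_zero ha (qroot_mono (not_le.1 h).le)]
  have hpt := levelAvg_le_of_le (b := polarBias p) (t := t₀)
    (f := fun x => exceedBound a s x + Real.binEntropy ((1 - x) / 2) / Real.log 2)
    (g := fun x => 1 + (if x ∈ Set.Icc γ (1 - γ) then 1 else 0) +
      (Real.binEntropy (γ / 2) / Real.log 2 + (10 / 3 * qroot γ + (3 / 4) ^ s / a)))
    fun j => exceedBound_add_binEntropy_le ha hγ hγ1 s (hb.le_one t₀ j)
  rw [levelAvg_add, levelAvg_add, levelAvg_add, levelAvg_const, levelAvg_const] at hpt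
  have hex := hb.levelAvg_exceedBound_le ha t₀ s
  have hent := binEntropy_div_le_levelAvg h0 h1 t₀
  linarith

end Polarization

/-! ### From measures to finite weights -/

section Measure

variable {Ω : Type*} [MeasurableSpace Ω] {A S : Type*} [Fintype A]

lemma measureReal_comp_preimage (μ : Measure Ω) [IsFiniteMeasure μ] (V : Ω → A)
    (hV : ∀ a, MeasurableSet (V ⁻¹' {a})) {w : A → ℝ} (hw : ∀ a, μ.real (V ⁻¹' {a}) = w a)
    (f : A → S) (s : S) : μ.real ((fun ω => f (V ω)) ⁻¹' {s}) = fiberWeight w f s := by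
  classical
  have : (fun ω => f (V ω)) ⁻¹' {s} = ⋃ a ∈ ({a | f a = s} : Finset A), V ⁻¹' {a} := by
    ext ω; simp
  rw [this, measureReal_biUnion_finset, fiberWeight]
  · exact Finset.sum_congr rfl fun a _ => hw a
  · intro a _ a' _ h
    exact Disjoint.preimage V (Set.disjoint_singleton.2 h)
  · exact fun a _ => hV a

lemma entropy_comp [Fintype S] (μ : Measure Ω) [IsFiniteMeasure μ] (V : Ω → A)
    (hV : ∀ a, MeasurableSet (V ⁻¹' {a})) {w : A → ℝ} (hw : ∀ a, μ.real (V ⁻¹' {a}) = w a)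
    (f : A → S) : entropy μ (fun ω => f (V ω)) = ent w f / Real.log 2 := by
  simp only [entropy, ent, measureReal_comp_preimage μ V hV hw, Finset.sum_div]

/-- The law conditioned on a cell has masses divided by the cell's weight. For a null cell the junk
value of the inverse is harmless, because the factor in front is 0. -/
lemma mul_negMulLog_add_negMulLog (a b : ℝ) (ha : 0 ≤ a) (hb : 0 ≤ b) :
    (a + b) * (Real.negMulLog ((a + b)⁻¹ * a) + Real.negMulLog ((a + b)⁻¹ * b)) = phi a b := by
  rcases (add_nonneg ha hb).eq_or_lt with h | h
  · have h1 : a = 0 := by linarith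
    have h2 : b = 0 := by linarith
    simp [h1, h2]
  · rw [phi, Real.negMulLog_mul, Real.negMulLog_mul]
    have : Real.negMulLog (a + b)⁻¹ = (a + b)⁻¹ * Real.log (a + b) := by
      rw [Real.negMulLog, Real.log_inv]; ring
    rw [this, Real.negMulLog.eq_def (a + b)]
    field_simp
    ring

lemma condEntropy_eq [Fintype S] [MeasurableSpace A] [MeasurableSingletonClass A]
    (μ : Measure A) [IsFiniteMeasure μ] {w : A → ℝ} (hw : ∀ a, μ.real {a} = w a)
    (Z : A → ZMod 2) (W : A → S) : condEntropy μ Z W = condEnt w Z W / Real.log 2 := by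
  have h0 : ∀ a, 0 ≤ w a := fun a => hw a ▸ measureReal_nonneg
  have hV : ∀ a : A, MeasurableSet (id ⁻¹' {a}) := fun a => measurableSet_singleton a
  rw [condEntropy, condEnt, Finset.sum_div]
  refine Finset.sum_congr rfl fun v _ => ?_
  have hP := measureReal_comp_preimage μ id hV hw W v
  have hj : ∀ a, W ⁻¹' {v} ∩ Z ⁻¹' {a} = (fun x => (Z (id x), W (id x))) ⁻¹' {(a, v)} := by
    intro a; ext x; simp [and_comm]
  have hc : ∀ a, (cond μ (W ⁻¹' {v})).real (Z ⁻¹' {a}) =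
      (fiberWeight w W v)⁻¹ * fiberWeight w (fun x => (Z x, W x)) (a, v) := by
    intro a
    rw [measureReal_def, cond_apply (Set.toFinite _).measurableSet, ENNReal.toReal_mul,
      ENNReal.toReal_inv, ← measureReal_def, ← measureReal_def, hj,
      measureReal_comp_preimage μ id hV hw (fun x => (Z x, W x)) (a, v)]
    congr 2
  rw [show μ.real (W ⁻¹' {v}) = fiberWeight w W v from hP, entropy, sum_zmod_two, hc, hc,
    fiberWeight_eq_add w Z W v, ← add_div, ← mul_div_assoc, mul_negMulLog_add_negMulLog _ _
    (fiberWeight_nonneg h0 _ _) (fiberWeight_nonneg h0 _ _)]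

lemma bernoulliLaw_real_singleton (p : unitInterval) (a : ZMod 2) :
    (bernoulliLaw p).real {a} = bernoulliWeight p a := by
  rw [bernoulliLaw, bernoulliMeasure_real_apply p (measurableSet_singleton a), bernoulliWeight]
  obtain rfl | rfl : a = 0 ∨ a = 1 := by revert a; decide
  · simp
  · simp

instance isProbabilityMeasure_bernoulliLaw (p : unitInterval) :
    IsProbabilityMeasure (bernoulliLaw p) := by
  unfold bernoulliLaw; infer_instance

lemma pi_bernoulliLaw_real_singleton {n : ℕ} (p : unitInterval) (x : Fin n → ZMod 2) :
    (Measure.pi fun _ : Fin n => bernoulliLaw p).real {x} = productWeight p x := by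
  rw [measureReal_def, ← Set.univ_pi_singleton, Measure.pi_pi, ENNReal.toReal_prod]
  exact Finset.prod_congr rfl fun i _ => bernoulliLaw_real_singleton p (x i)

lemma polarCondEntropy_eq (t : ℕ) (p : unitInterval) (j : Fin (2 ^ t)) :
    polarCondEntropy t p j = polarEnt p t j / Real.log 2 :=
  condEntropy_eq _ (pi_bernoulliLaw_real_singleton p) _ _

lemma IsIIDBernoulli.measurableSet_preimage {n : ℕ} {p : unitInterval} {μ : Measure Ω}
    {X : Fin n → Ω → ZMod 2} (h : IsIIDBernoulli p μ X) (x : Fin n → ZMod 2) :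
    MeasurableSet ((fun ω i => X i ω) ⁻¹' {x}) :=
  measurable_pi_lambda _ h.measurable (measurableSet_singleton x)

lemma IsIIDBernoulli.measureReal_preimage {n : ℕ} {p : unitInterval} {μ : Measure Ω}
    [IsProbabilityMeasure μ] {X : Fin n → Ω → ZMod 2} (h : IsIIDBernoulli p μ X)
    (x : Fin n → ZMod 2) : μ.real ((fun ω i => X i ω) ⁻¹' {x}) = productWeight p x := by
  have hm := (iIndepFun_iff_map_fun_eq_pi_map fun i => (h.measurable i).aemeasurable).1 h.indep
  simp only [h.law] at hm
  rw [← pi_bernoulliLaw_real_singleton, ← hm, map_measureReal_apply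
    (measurable_pi_lambda _ h.measurable) (measurableSet_singleton x)]

/-- Min-entropy is at most Shannon entropy. -/
lemma neg_log_iSup_le_ent {w : A → ℝ} (h0 : ∀ a, 0 ≤ w a) (h1 : ∑ a, w a = 1) :
    -Real.log (⨆ a, w a) ≤ ent w id := by
  have hle : ∀ a, w a ≤ ⨆ a, w a := le_ciSup (Set.finite_range w).bddAbove
  rw [← one_mul (-Real.log _), ← h1, Finset.sum_mul, ent]
  refine Finset.sum_le_sum fun a _ => ?_
  rw [fiberWeight_id, Real.negMulLog, neg_mul, mul_neg, neg_le_neg_iff]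
  rcases (h0 a).eq_or_lt with h | h
  · simp [← h]
  · exact mul_le_mul_of_nonneg_left (Real.log_le_log h (hle a)) h.le

end Measure

/-! ### The extractor: uniformity and output length -/

section Extractor

lemma IsParam.eq {t : ℕ} {k : ℝ} {q : unitInterval} (h : IsParam t k q) :
    2 ^ t * Real.binEntropy q / Real.log 2 = k := by
  rw [IsParam, bernoulliEntropy, eq_div_iff (by positivity)] at h
  rw [← h]; ring

lemma binEntropy_le_of_le {Ω : Type*} [MeasurableSpace Ω] {μ : Measure Ω}
    [IsProbabilityMeasure μ] {t : ℕ} {k : ℝ} {p q : unitInterval} (hq : IsParam t k q)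
    {X : Fin (2 ^ t) → Ω → ZMod 2} (hX : IsIIDBernoulli p μ X)
    (hk : k ≤ entropy μ (fun ω i => X i ω) ∨ k ≤ minEntropy μ (fun ω i => X i ω)) :
    Real.binEntropy q ≤ Real.binEntropy p := by
  have hlog : 0 < Real.log 2 := Real.log_pos one_lt_two
  have h : k ≤ ent (productWeight p : (Fin (2 ^ t) → ZMod 2) → ℝ) id / Real.log 2 := by
    rcases hk with hk | hk
    · exact hk.trans_eq (entropy_comp μ _ hX.measurableSet_preimage hX.measureReal_preimage id)
    · refine hk.trans ?_
      simp only [minEntropy, hX.measureReal_preimage, Real.logb, ← neg_div]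
      exact div_le_div_of_nonneg_right (neg_log_iSup_le_ent (productWeight_nonneg p.2.1 p.2.2)
        (sum_productWeight _ _)) hlog.le
  rw [ent_productWeight, ← hq.eq, div_le_div_iff_of_pos_right hlog] at h
  exact le_of_mul_le_mul_left h (by positivity)

lemma pextLength_le (t : ℕ) (ε : ℝ) (q : unitInterval) : (pextLength t ε q : ℝ) ≤ 2 ^ t := by
  have := Finset.card_le_univ (pextSet t ε q)
  rw [Fintype.card_fin] at this
  exact_mod_cast this

lemma mem_pextSet {t : ℕ} {ε : ℝ} {q : unitInterval} {j : Fin (2 ^ t)} :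
    j ∈ pextSet t ε q ↔ (1 - ε ^ 2 / (2 * 2 ^ t)) * Real.log 2 ≤ polarEnt q t j := by
  rw [pextSet, highEntropySet, Finset.mem_filter, polarCondEntropy_eq,
    le_div_iff₀ (Real.log_pos one_lt_two)]
  simp

/-- Selection is made at `q` but the source has parameter `p`: monotonicity transfers the entropy
bound to each kept index, and the chain rule adds them up. -/
lemma pextLength_mul_le_ent {p q : unitInterval} (h : Real.binEntropy q ≤ Real.binEntropy p)
    (t : ℕ) (ε : ℝ) : pextLength t ε q * ((1 - ε ^ 2 / (2 * 2 ^ t)) * Real.log 2) ≤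
      ent (productWeight p) (pext t ε q) := by
  refine le_trans ?_ (sum_condEnt_le_ent (productWeight_nonneg p.2.1 p.2.2)
    (sum_productWeight _ _) (polarTransform t) (pextSet t ε q))
  rw [pextLength, ← nsmul_eq_mul]
  exact Finset.card_nsmul_le_sum _ _ _ fun j hj => (mem_pextSet.1 hj).trans
    (polarEnt_mono p.2.1 p.2.2 q.2.1 q.2.2 h t j)

lemma isEntropyUniform_pext {Ω : Type*} [MeasurableSpace Ω] {μ : Measure Ω}
    [IsProbabilityMeasure μ] {ε : ℝ} (hε₀ : 0 < ε) (hε₁ : ε < 1) {t : ℕ} {p q : unitInterval}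
    (h : Real.binEntropy q ≤ Real.binEntropy p) {X : Fin (2 ^ t) → Ω → ZMod 2}
    (hX : IsIIDBernoulli p μ X) :
    IsEntropyUniform ε μ (fun ω => pext t ε q (fun i => X i ω)) := by
  rw [IsEntropyUniform, entropy_comp μ _ hX.measurableSet_preimage hX.measureReal_preimage,
    le_div_iff₀ (Real.log_pos one_lt_two), Fintype.card_coe, mul_assoc]
  refine le_trans ?_ (pextLength_mul_le_ent h t ε)
  have h2 : (1 : ℝ) ≤ 2 ^ t := one_le_pow₀ one_le_two
  have : ε ^ 2 / (2 * 2 ^ t) ≤ ε := by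
    rw [div_le_iff₀ (by positivity)]
    nlinarith
  have hlog : 0 < Real.log 2 := Real.log_pos one_lt_two
  rw [pextLength]
  gcongr

lemma isL1Uniform_pext {Ω : Type*} [MeasurableSpace Ω] {μ : Measure Ω}
    [IsProbabilityMeasure μ] {ε : ℝ} (hε₀ : 0 < ε) {t : ℕ} {p q : unitInterval}
    (h : Real.binEntropy q ≤ Real.binEntropy p) {X : Fin (2 ^ t) → Ω → ZMod 2}
    (hX : IsIIDBernoulli p μ X) :
    IsL1Uniform ε μ (fun ω => pext t ε q (fun i => X i ω)) := by
  rw [IsL1Uniform]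
  simp only [measureReal_comp_preimage μ _ hX.measurableSet_preimage hX.measureReal_preimage]
  have hpin := sq_sum_abs_sub_le (fiberWeight (productWeight p) (pext t ε q))
    (fiberWeight_nonneg (productWeight_nonneg p.2.1 p.2.2) _)
    ((sum_fiberWeight _ _).trans (sum_productWeight _ _))
  have hcard : (Fintype.card (pextSet t ε q → ZMod 2) : ℝ) =
      2 ^ Fintype.card (pextSet t ε q) := by
    rw [Fintype.card_fun, ZMod.card]; push_cast; rfl
  rw [hcard, Real.log_pow, Fintype.card_coe] at hpin
  rw [Fintype.card_coe]
  refine abs_le_of_sq_le_sq' (hpin.trans ?_) hε₀.le |>.2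
  have hent := pextLength_mul_le_ent h t ε
  have hm := pextLength_le t ε q
  rw [ent, pextLength] at hent
  rw [pextLength] at hm
  have hlog : 0 < Real.log 2 := Real.log_pos one_lt_two
  have hlog1 : Real.log 2 ≤ 1 := by linarith [Real.log_two_lt_d9]
  -- Each kept bit loses at most ε²/(2n), and at most n bits are kept. Pinsker doubles the total
  -- ε²/2, and `log 2 ≤ 1` covers the passage from bits to nats.
  have h3 : ((pextSet t ε q).card : ℝ) * (ε ^ 2 / (2 * 2 ^ t)) ≤ ε ^ 2 / 2 := by
    refine (mul_le_mul_of_nonneg_right hm (by positivity)).trans (le_of_eq ?_)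
    field_simp
  have h4 := mul_le_mul_of_nonneg_right h3 hlog.le
  have h5 : ε ^ 2 * Real.log 2 ≤ ε ^ 2 := mul_le_of_le_one_right (sq_nonneg ε) hlog1
  linarith

/-- The selected entropies are part of a sum equal to k, so m - k is at most m ε²/(2n) ≤ ε²/2. -/
lemma pextLength_le_add {ε : ℝ} (hε₀ : 0 < ε) (hε₁ : ε < 1) {t : ℕ} {k : ℝ} {q : unitInterval}
    (hq : IsParam t k q) : (pextLength t ε q : ℝ) ≤ k + 1 / 2 := by
  have hlog : 0 < Real.log 2 := Real.log_pos one_lt_two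
  have h1 : (pextLength t ε q : ℝ) * ((1 - ε ^ 2 / (2 * 2 ^ t)) * Real.log 2) ≤
      2 ^ t * Real.binEntropy q := by
    rw [← sum_polarEnt, pextLength, ← nsmul_eq_mul]
    refine (Finset.card_nsmul_le_sum _ _ _ fun j hj => mem_pextSet.1 hj).trans
      (Finset.sum_le_sum_of_subset_of_nonneg (Finset.subset_univ _) fun j _ _ => ?_)
    exact (mul_nonneg (sub_nonneg.2 (bias_le_one (productWeight_nonneg q.2.1 q.2.2)
      (sum_productWeight _ _) _ _)) hlog.le).trans (one_sub_bias_mul_log_two_le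
      (productWeight_nonneg q.2.1 q.2.2) (sum_productWeight _ _) _ _)
  have h2 : (pextLength t ε q : ℝ) * (1 - ε ^ 2 / (2 * 2 ^ t)) ≤ k := by
    rwa [← hq.eq, le_div_iff₀ hlog, mul_assoc]
  have h3 : (pextLength t ε q : ℝ) * (ε ^ 2 / (2 * 2 ^ t)) ≤ ε ^ 2 / 2 := by
    refine (mul_le_mul_of_nonneg_right (pextLength_le t ε q) (by positivity)).trans
      (le_of_eq ?_)
    field_simp
  nlinarith

open Classical in
lemma levelAvg_le_pextLength (t : ℕ) (ε : ℝ) (q : unitInterval) :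
    levelAvg (polarBias q) (fun x => if x ≤ ε ^ 2 / 2 / 2 ^ t then 1 else 0) t ≤
      pextLength t ε q / 2 ^ t := by
  refine div_le_div_of_nonneg_right ?_ (by positivity)
  rw [Finset.sum_boole, pextLength]
  refine Nat.cast_le.2 (Finset.card_le_card fun j hj => mem_pextSet.2 ?_)
  have hj := (Finset.mem_filter.1 hj).2
  rw [div_div] at hj
  refine le_trans (mul_le_mul_of_nonneg_right ?_ (Real.log_nonneg one_le_two))
    (one_sub_bias_mul_log_two_le (productWeight_nonneg q.2.1 q.2.2) (sum_productWeight _ _) _ _)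
  exact sub_le_sub_left hj 1

theorem exists_abs_pextLength_sub_le {ε : ℝ} (hε₀ : 0 < ε) (hε₁ : ε < 1) {δ : ℝ} (hδ : 0 < δ) :
    ∃ T : ℕ, ∀ t : ℕ, T ≤ t → ∀ (k : ℝ) (q : unitInterval), IsParam t k q →
      |(pextLength t ε q : ℝ) - k| ≤ δ * 2 ^ t := by
  obtain ⟨T₁, hT₁⟩ := exists_level_small_bias (c := ε ^ 2 / 2) (by positivity) hδ
  -- Makes δn > 1, which absorbs the excess 1/2 in the upper bound.
  obtain ⟨T₂, hT₂⟩ := pow_unbounded_of_one_lt (1 / δ) one_lt_two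
  refine ⟨max T₁ T₂, fun t ht k q hq => abs_le.2 ⟨?_, ?_⟩⟩
  · have h := (hT₁ t ((le_max_left _ _).trans ht) q q.2.1 q.2.2).trans
      (levelAvg_le_pextLength t ε q)
    rw [le_div_iff₀ (by positivity)] at h
    have hk := hq.eq
    rw [mul_div_assoc] at hk
    linarith
  · have h1 := pextLength_le_add hε₀ hε₁ hq
    have h2 : 1 / δ < 2 ^ t :=
      hT₂.trans_le (pow_le_pow_right₀ one_le_two ((le_max_right _ _).trans ht))
    rw [div_lt_iff₀ hδ] at h2
    linarith

end Extractor

end PolarExtractor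

theorem mainTheorem7 (ε : ℝ) (hε₀ : 0 < ε) (hε₁ : ε < 1) :
    (∀ (t : ℕ) (k : ℝ) (q : unitInterval), PolarExtractor.IsParam t k q →
      ∀ (Ω : Type*) [MeasurableSpace Ω] (μ : MeasureTheory.Measure Ω)
        [MeasureTheory.IsProbabilityMeasure μ] (p : unitInterval)
        (X : Fin (2 ^ t) → Ω → ZMod 2),
        PolarExtractor.IsIIDBernoulli p μ X →
        (k ≤ PolarExtractor.entropy μ (fun ω i => X i ω) ∨
          k ≤ PolarExtractor.minEntropy μ (fun ω i => X i ω)) →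
        PolarExtractor.IsEntropyUniform ε μ
            (fun ω => PolarExtractor.pext t ε q (fun i => X i ω)) ∧
          PolarExtractor.IsL1Uniform ε μ
            (fun ω => PolarExtractor.pext t ε q (fun i => X i ω))) ∧
    (∀ δ : ℝ, 0 < δ → ∃ T : ℕ, ∀ t : ℕ, T ≤ t → ∀ (k : ℝ) (q : unitInterval), PolarExtractor.IsParam t k q →
      |(PolarExtractor.pextLength t ε q : ℝ) - k| ≤ δ * 2 ^ t) := by
  refine ⟨fun t k q hq Ω _ μ _ p X hX hk => ?_,
    fun δ hδ => PolarExtractor.exists_abs_pextLength_sub_le hε₀ hε₁ hδ⟩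
  have h := PolarExtractor.binEntropy_le_of_le hq hX hk
  exact ⟨PolarExtractor.isEntropyUniform_pext hε₀ hε₁ h hX,
    PolarExtractor.isL1Uniform_pext hε₀ h hX⟩
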